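/- Let $\mathcal A$ be a von Neumann algebra acting on a complex Hilbert space $H$, and let $\tau$ be a faithful normal tracial state on $\mathcal A$. A self-adjoint, possibly unbounded, operator on $H$ is affiliated with $\mathcal A$ if all its spectral projections lie in $\mathcal A$; its distribution is then the probability measure $S\mapsto\tau[\mathbf 1_S(a)]$ on $\mathbb R$. For self-adjoint affiliated operators $a_N,a$, we say that $a_N\to a$ in probability if the distributions of $|a_N-a|$ converge weakly to $\delta_0$. Here and below, sums and differences of affiliated operators denote the closures of the operators defined on the common domain, and $|b|=\sqrt{b^*b}$. **Proposition.** Let $k\ge 0$ and let $x_{i,N}$, $x_i$ ($1\le i\le k$, $N\in\mathbb N$) be self-adjoint operators affiliated with $\mathcal A$ such that, for each $i$, $x_{i,N}\to x_i$ in probability as $N\to\infty$. Then for every $d$, all Hermitian matrices $A_1,\dots,A_k\in M_d(\mathbb C)$ and every $B\in M_d(\mathbb C)$ with $\operatorname{Im}B=\frac{1}{2i}(B-B^*)>\varepsilon I$ for some $\varepsilon>0$, the operators $B\otimes 1-\sum_i A_i\otimes x_{i,N}$ and $B\otimes 1-\sum_i A_i\otimes x_i$ on $\mathbb C^d\otimes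 H$ have bounded inverses, which lie in $M_d(\mathbb C)\otimes\mathcal A=M_d(\mathcal A)$, and $$(I\otimes\tau)\Big[\Big(B\otimes 1-\sum_{i=1}^k A_i\otimes x_{i,N}\Big)^{-1}\Big]\longrightarrow (I\otimes\tau)\Big[\Big(B\otimes 1-\sum_{i=1}^k A_i\otimes x_{i}\Big)^{-1}\Big]$$ in norm in $M_d(\mathbb C)$ as $N\to\infty$. -/

import Mathlib

open Filter Topology MeasureTheory
open scoped ComplexStarModule InnerProductSpace BoundedContinuousFunction ComplexOrder

namespace FreeProb

noncomputable section

universe u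

/-! ## W*-probability spaces -/

/-- `τ` is a faithful normal tracial state on the von Neumann algebra `M`.
Normality: `τ` preserves suprema of bounded increasing nets (directed sets) of self-adjoint
elements, for the Loewner order of `B(H)`. -/
structure IsFaithfulNormalTracialState {H : Type u} [NormedAddCommGroup H]
    [InnerProductSpace ℂ H] [CompleteSpace H] {M : VonNeumannAlgebra H}
    (τ : M.toStarSubalgebra →ₗ[ℂ] ℂ) : Prop where
  map_one : τ 1 = 1
  nonneg : ∀ a, 0 ≤ τ (star a * a)
  trace : ∀ a b, τ (a * b) = τ (b * a)
  faithful : ∀ a, τ (star a * a) = 0 → a = 0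
  normal : ∀ (S : Set M.toStarSubalgebra) (s : M.toStarSubalgebra), S.Nonempty →
    (∀ a ∈ S, IsSelfAdjoint a) →
    DirectedOn (· ≤ ·) ((fun a : M.toStarSubalgebra => (a : H →L[ℂ] H)) '' S) →
    IsLUB ((fun a : M.toStarSubalgebra => (a : H →L[ℂ] H)) '' S) (s : H →L[ℂ] H) →
    IsLUB ((fun a => (τ a).re) '' S) (τ s).re

/-! ## Spectral measures of unbounded self-adjoint operators -/

/-- A projection-valued measure on the Borel sets of `ℝ` with values in `B(H)`
(the values on non-measurable sets are irrelevant). -/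
structure ProjectionValuedMeasure (H : Type u) [NormedAddCommGroup H]
    [InnerProductSpace ℂ H] [CompleteSpace H] where
  proj : Set ℝ → H →L[ℂ] H
  isStarProjection : ∀ S, MeasurableSet S → IsStarProjection (proj S)
  proj_empty : proj ∅ = 0
  proj_univ : proj Set.univ = 1
  proj_inter : ∀ S T, MeasurableSet S → MeasurableSet T →
    proj (S ∩ T) = proj S * proj T
  hasSum_iUnion : ∀ S : ℕ → Set ℝ, (∀ n, MeasurableSet (S n)) →
    Pairwise (fun m n => Disjoint (S m) (S n)) →
    ∀ ξ : H, HasSum (fun n => proj (S n) ξ) (proj (⋃ n, S n) ξ)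

variable {H : Type u} [NormedAddCommGroup H] [InnerProductSpace ℂ H] [CompleteSpace H]

theorem ProjectionValuedMeasure.re_inner_eq (E : ProjectionValuedMeasure H) {S : Set ℝ}
    (hS : MeasurableSet S) (ξ : H) : (⟪ξ, E.proj S ξ⟫_ℂ).re = ‖E.proj S ξ‖ ^ 2 := by
  have h := E.isStarProjection S hS
  have h1 : E.proj S ξ = E.proj S (E.proj S ξ) := by
    conv_lhs => rw [← h.isIdempotentElem.eq]
    rfl
  have h2 : ⟪ξ, E.proj S ξ⟫_ℂ = ⟪E.proj S ξ, E.proj S ξ⟫_ℂ := by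
    conv_lhs => rw [h1]
    rw [← ContinuousLinearMap.adjoint_inner_left, ← ContinuousLinearMap.star_eq_adjoint,
      h.isSelfAdjoint.star_eq]
  rw [h2, inner_self_eq_norm_sq_to_K]
  norm_cast

/-- The scalar measure `S ↦ ⟨ξ, E(S) ξ⟩`. -/
def ProjectionValuedMeasure.scalarMeasure (E : ProjectionValuedMeasure H) (ξ : H) :
    Measure ℝ :=
  Measure.ofMeasurable (fun S _ => ENNReal.ofReal (⟪ξ, E.proj S ξ⟫_ℂ).re)
    (by simp [E.proj_empty])
    (by
      intro S hS hd
      have h1 : HasSum (fun n => (⟪ξ, E.proj (S n) ξ⟫_ℂ).re)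
          (⟪ξ, E.proj (⋃ n, S n) ξ⟫_ℂ).re :=
        (Complex.reCLM.hasSum ((innerSL ℂ ξ).hasSum (E.hasSum_iUnion S hS hd ξ)))
      rw [← h1.tsum_eq, ENNReal.ofReal_tsum_of_nonneg _ h1.summable]
      intro n
      rw [E.re_inner_eq (hS n)]
      positivity)

/-- `E` is the spectral measure of the (possibly unbounded) operator `a`, i.e. `a = ∫ t dE(t)`:
the domain of `a` consists of the `ξ` with `∫ t² d⟨ξ, E(t) ξ⟩ < ∞`, and on it
`⟨ξ, a ξ⟩ = ∫ t d⟨ξ, E(t) ξ⟩`. -/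
structure IsSpectralMeasure (a : H →ₗ.[ℂ] H) (E : ProjectionValuedMeasure H) : Prop where
  mem_domain_iff : ∀ ξ : H,
    ξ ∈ a.domain ↔ ∫⁻ t, ENNReal.ofReal (t ^ 2) ∂(E.scalarMeasure ξ) < ⊤
  inner_apply : ∀ ξ : a.domain,
    ⟪(ξ : H), a ξ⟫_ℂ = ((∫ t, t ∂(E.scalarMeasure (ξ : H)) : ℝ) : ℂ)

/-- The self-adjoint operator `a` is affiliated with `M`: all its spectral projections
lie in `M`. -/
def IsAffiliatedSelfAdjoint (M : VonNeumannAlgebra H) (a : H →ₗ.[ℂ] H) : Prop :=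
  IsSelfAdjoint a ∧ ∃ E : ProjectionValuedMeasure H, IsSpectralMeasure a E ∧
    ∀ S, MeasurableSet S → E.proj S ∈ M.toStarSubalgebra

/-! ## Distributions and convergence in probability -/

/-- `μ` is the distribution of the self-adjoint affiliated operator `a` with respect to `τ`:
`μ S = τ (1_S(a))` for every Borel set `S`. -/
def IsDistribution {M : VonNeumannAlgebra H} (τ : M.toStarSubalgebra →ₗ[ℂ] ℂ)
    (a : H →ₗ.[ℂ] H) (μ : Measure ℝ) : Prop :=
  IsProbabilityMeasure μ ∧ ∃ E : ProjectionValuedMeasure H, IsSpectralMeasure a E ∧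
    ∀ S, MeasurableSet S → ∃ h : E.proj S ∈ M.toStarSubalgebra,
      τ ⟨E.proj S, h⟩ = (μ.real S : ℂ)

open scoped Classical in
/-- The distribution of a self-adjoint affiliated operator. For operators that have no
distribution the value is the zero measure. -/
def distribution {M : VonNeumannAlgebra H} (τ : M.toStarSubalgebra →ₗ[ℂ] ℂ)
    (a : H →ₗ.[ℂ] H) : Measure ℝ :=
  if h : ∃ μ, IsDistribution τ a μ then h.choose else 0

/-- `c = |b| = √(b* b)`: the operator `c` is self-adjoint and positive, and `c² = b* b` as
unbounded operators (with the natural domains of the products). -/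
structure IsAbsoluteValue (b c : H →ₗ.[ℂ] H) : Prop where
  isSelfAdjoint : IsSelfAdjoint c
  nonneg : ∀ ξ : c.domain, 0 ≤ (⟪(ξ : H), c ξ⟫_ℂ).re
  sq_eq : ∀ ξ η : H,
    (∃ ζ, (ξ, ζ) ∈ c.graph ∧ (ζ, η) ∈ c.graph) ↔
      (∃ ζ, (ξ, ζ) ∈ b.graph ∧ (ζ, η) ∈ b.adjoint.graph)

open scoped Classical in
/-- The absolute value `|b| = √(b* b)` of a closed densely defined operator. For operators
without an absolute value the result is the operator with domain `{0}`, which is not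
self-adjoint and has no distribution unless `H = 0`. -/
def absoluteValue (b : H →ₗ.[ℂ] H) : H →ₗ.[ℂ] H :=
  if h : ∃ c, IsAbsoluteValue b c then h.choose else ⊥

/-- The difference `a - b` in the algebra of affiliated operators: the closure of the
difference on the common domain. -/
def strongSub (a b : H →ₗ.[ℂ] H) : H →ₗ.[ℂ] H := (a - b).closure

/-- `a n → a` in probability: the distributions of `|a n - a|` converge weakly to `δ₀`. -/
def TendstoInProbability {M : VonNeumannAlgebra H} (τ : M.toStarSubalgebra →ₗ[ℂ] ℂ)
    (a : ℕ → H →ₗ.[ℂ] H) (a₀ : H →ₗ.[ℂ] H) : Prop :=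
  ∀ f : ℝ →ᵇ ℝ,
    Tendsto (fun n => ∫ t, f t ∂(distribution τ (absoluteValue (strongSub (a n) a₀))))
      atTop (𝓝 (∫ t, f t ∂(Measure.dirac (0 : ℝ))))

/-! ## Matricial Cauchy transforms -/

/-- The operator `A ⊗ x` on `ℂᵈ ⊗ H = Hᵈ`, with domain `ℂᵈ ⊗ dom x = (dom x)ᵈ`:
`(A ⊗ x) ξ = (∑ l, A j l • x (ξ l))_j`. -/
def matrixTensor {d : ℕ} (A : Matrix (Fin d) (Fin d) ℂ) (x : H →ₗ.[ℂ] H) :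
    PiLp 2 (fun _ : Fin d => H) →ₗ.[ℂ] PiLp 2 (fun _ : Fin d => H) where
  domain :=
    { carrier := {ξ | ∀ l, ξ l ∈ x.domain}
      add_mem' := fun hξ hη l => x.domain.add_mem (hξ l) (hη l)
      zero_mem' := fun _ => x.domain.zero_mem
      smul_mem' := fun c _ hξ l => x.domain.smul_mem c (hξ l) }
  toFun :=
    { toFun := fun ξ =>
        WithLp.toLp 2 (fun j => ∑ l, A j l • x ⟨(ξ : PiLp 2 (fun _ : Fin d => H)) l, ξ.2 l⟩)
      map_add' := by
        intro ξ η
        ext j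
        simp only [PiLp.add_apply, ← Finset.sum_add_distrib, ← smul_add]
        refine Finset.sum_congr rfl fun l _ => ?_
        rw [← LinearPMap.map_add]
        rfl
      map_smul' := by
        intro c ξ
        ext j
        simp only [PiLp.smul_apply, Finset.smul_sum, RingHom.id_apply]
        refine Finset.sum_congr rfl fun l _ => ?_
        rw [smul_comm c]
        congr 1
        rw [← LinearPMap.map_smul]
        rfl }

/-- The everywhere defined identity operator. -/
def idOp (H : Type u) [NormedAddCommGroup H] [InnerProductSpace ℂ H] : H →ₗ.[ℂ] H :=
  (LinearMap.id : H →ₗ[ℂ] H).toPMap ⊤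

/-- The operator `B ⊗ 1 - ∑ i, A i ⊗ x i` affiliated with `M_d(M)`: the closure of the operator
defined on the common domain of the terms. -/
def pencil {d k : ℕ} (B : Matrix (Fin d) (Fin d) ℂ) (A : Fin k → Matrix (Fin d) (Fin d) ℂ)
    (x : Fin k → H →ₗ.[ℂ] H) :
    PiLp 2 (fun _ : Fin d => H) →ₗ.[ℂ] PiLp 2 (fun _ : Fin d => H) :=
  (matrixTensor B (idOp H) - ∑ i, matrixTensor (A i) (x i)).closure

/-- `R ∈ M_d(M)` is the inverse of the unbounded operator `T` on `Hᵈ`: the graph of `T` is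
`{(R η, η) : η ∈ Hᵈ}`, so that `T` is a bijection from its domain onto `Hᵈ` with
inverse `R`. -/
def IsBoundedInverse {M : VonNeumannAlgebra H} {d : ℕ}
    (T : PiLp 2 (fun _ : Fin d => H) →ₗ.[ℂ] PiLp 2 (fun _ : Fin d => H))
    (R : Matrix (Fin d) (Fin d) M.toStarSubalgebra) : Prop :=
  ∀ ξ η : PiLp 2 (fun _ : Fin d => H),
    (ξ, η) ∈ T.graph ↔ ∀ j, ξ j = ∑ l, (R j l : H →L[ℂ] H) (η l)

open scoped Matrix.Norms.L2Operator in
/-- Joint convergence in distribution through matricial Cauchy transforms: for all `d`, all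
Hermitian `A i ∈ M_d(ℂ)` and all `B ∈ M_d(ℂ)` with `Im B > ε I` for some `ε > 0`, the inverses
of the operators `B ⊗ 1 - ∑ A i ⊗ x i N` and `B ⊗ 1 - ∑ A i ⊗ x i` exist in `M_d(M)`, and
their images under `I ⊗ τ` converge in norm in `M_d(ℂ)`. -/
def TendstoJointlyInDistribution {M : VonNeumannAlgebra H} (τ : M.toStarSubalgebra →ₗ[ℂ] ℂ)
    {k : ℕ} (X : Fin k → ℕ → H →ₗ.[ℂ] H) (x : Fin k → H →ₗ.[ℂ] H) : Prop :=
  ∀ (d : ℕ) (A : Fin k → Matrix (Fin d) (Fin d) ℂ) (B : Matrix (Fin d) (Fin d) ℂ),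
    (∀ i, (A i).IsHermitian) →
    (∃ ε : ℝ, 0 < ε ∧
      ((ℑ B : Matrix (Fin d) (Fin d) ℂ) - (ε : ℂ) • (1 : Matrix (Fin d) (Fin d) ℂ)).PosDef) →
    ∃ (RN : ℕ → Matrix (Fin d) (Fin d) M.toStarSubalgebra)
      (R : Matrix (Fin d) (Fin d) M.toStarSubalgebra),
      (∀ N, IsBoundedInverse (pencil B A (fun i => X i N)) (RN N)) ∧
      IsBoundedInverse (pencil B A x) R ∧
      Tendsto (fun N => ‖(RN N).map τ - R.map τ‖) atTop (𝓝 0)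

end

end FreeProb

namespace FreeProb

noncomputable section

/-- A faithful positive trace `t`, continuous along strongly convergent increasing sequences, on the
commutant of a self-adjoint set `comm` of bounded operators. The values of `t` outside of the
commutant are irrelevant. -/
structure TraceData (K : Type*) [NormedAddCommGroup K] [InnerProductSpace ℂ K]
    [CompleteSpace K] where
  comm : Set (K →L[ℂ] K)
  star_mem_comm : ∀ y ∈ comm, star y ∈ comm
  t : (K →L[ℂ] K) → ℝ
  map_add : ∀ a ∈ StarSubalgebra.centralizer ℂ comm, ∀ b ∈ StarSubalgebra.centralizer ℂ comm,
    t (a + b) = t a + t b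
  star_mul_self_nonneg : ∀ a ∈ StarSubalgebra.centralizer ℂ comm, 0 ≤ t (star a * a)
  faithful : ∀ a ∈ StarSubalgebra.centralizer ℂ comm, t (star a * a) = 0 → a = 0
  map_mul_comm : ∀ a ∈ StarSubalgebra.centralizer ℂ comm,
    ∀ b ∈ StarSubalgebra.centralizer ℂ comm, t (a * b) = t (b * a)
  normal : ∀ (a : ℕ → K →L[ℂ] K) (b : K →L[ℂ] K),
    (∀ n, a n ∈ StarSubalgebra.centralizer ℂ comm) → (∀ n, IsSelfAdjoint (a n)) → Monotone a →
    (∀ ξ, Tendsto (fun n => a n ξ) atTop (𝓝 (b ξ))) → Tendsto (fun n => t (a n)) atTop (𝓝 (t b))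

namespace TraceData

variable {K : Type*} [NormedAddCommGroup K] [InnerProductSpace ℂ K] [CompleteSpace K]
  (F : TraceData K)

/-- The algebra on which the trace lives. -/
def alg : StarSubalgebra ℂ (K →L[ℂ] K) := StarSubalgebra.centralizer ℂ F.comm

theorem mem_alg {a : K →L[ℂ] K} : a ∈ F.alg ↔ ∀ y ∈ F.comm, Commute y a := by
  rw [alg, StarSubalgebra.mem_centralizer_iff]
  exact ⟨fun h y hy => (h y hy).1, fun h y hy => ⟨h y hy, h _ (F.star_mem_comm y hy)⟩⟩

theorem map_zero : F.t 0 = 0 := by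
  have := F.map_add 0 (zero_mem _) 0 (zero_mem _)
  simpa using this

theorem map_sub {a b : K →L[ℂ] K} (ha : a ∈ F.alg) (hb : b ∈ F.alg) :
    F.t (a - b) = F.t a - F.t b := by
  have := F.map_add (a - b) (sub_mem ha hb) b hb
  rw [sub_add_cancel] at this
  linarith

theorem cfc_mem {a : K →L[ℂ] K} (ha : a ∈ F.alg) (f : ℝ → ℝ) : cfc f a ∈ F.alg := by
  rw [mem_alg] at ha ⊢
  exact fun y hy => ((ha y hy).symm.cfc_real f).symm

theorem map_nonneg {a : K →L[ℂ] K} (ha : a ∈ F.alg) (h : 0 ≤ a) : 0 ≤ F.t a := by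
  have hs : IsSelfAdjoint a := .of_nonneg h
  have h1 : star (cfc Real.sqrt a) * cfc Real.sqrt a = a := by
    rw [(cfc_predicate Real.sqrt a : IsSelfAdjoint _).star_eq, ← cfc_mul Real.sqrt Real.sqrt a]
    conv_rhs => rw [← cfc_id' ℝ a]
    exact cfc_congr fun x hx => Real.mul_self_sqrt (spectrum_nonneg_of_nonneg h hx)
  rw [← h1]
  exact F.star_mul_self_nonneg _ (F.cfc_mem ha _)

theorem map_mono {a b : K →L[ℂ] K} (ha : a ∈ F.alg) (hb : b ∈ F.alg) (h : a ≤ b) :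
    F.t a ≤ F.t b := by
  have := F.map_nonneg (sub_mem hb ha) (sub_nonneg.2 h)
  rw [F.map_sub hb ha] at this
  linarith

/-- The subspace is invariant under the commutant. -/
def Inv (V : Submodule ℂ K) : Prop := ∀ y ∈ F.comm, ∀ v ∈ V, y v ∈ V

variable {F}

theorem Inv.orthogonal {V : Submodule ℂ K} (h : F.Inv V) : F.Inv Vᗮ := by
  intro y hy v hv
  rw [Submodule.mem_orthogonal] at hv ⊢
  intro u hu
  have := hv (star y u) (h _ (F.star_mem_comm y hy) u hu)
  rwa [ContinuousLinearMap.star_eq_adjoint, ContinuousLinearMap.adjoint_inner_left] at this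

theorem Inv.inf {V W : Submodule ℂ K} (h : F.Inv V) (h' : F.Inv W) : F.Inv (V ⊓ W) :=
  fun y hy v hv => ⟨h y hy v hv.1, h' y hy v hv.2⟩

theorem Inv.starProjection_mem {V : Submodule ℂ K} [V.HasOrthogonalProjection] (h : F.Inv V) :
    V.starProjection ∈ F.alg := by
  rw [mem_alg]
  intro y hy
  ext x
  have h2 := h.orthogonal
  simp only [mul_apply_eq_comp]
  symm
  apply Submodule.eq_starProjection_of_mem_orthogonal
  · exact h y hy _ (Submodule.starProjection_apply_mem _ _)
  · rw [← _root_.map_sub]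
    exact h2 y hy _ (Submodule.sub_starProjection_mem_orthogonal _)

theorem inv_ker {Y : K →L[ℂ] K} (hY : Y ∈ F.alg) : F.Inv (LinearMap.ker Y.toLinearMap) := by
  intro y hy v hv
  have := congrArg (· v) (F.mem_alg.1 hY y hy).eq
  simp only [mul_apply_eq_comp] at this
  simp_all

theorem inv_range {Y : K →L[ℂ] K} (hY : Y ∈ F.alg) : F.Inv (LinearMap.range Y.toLinearMap) := by
  rintro y hy _ ⟨v, rfl⟩
  exact ⟨y v, (congrArg (· v) (F.mem_alg.1 hY y hy).eq).symm⟩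

variable (F)

/-- The dimension of the orthogonal complement of a subspace. -/
def codim (V : Submodule ℂ K) : ℝ := F.t Vᗮ.starProjection

variable {F}

theorem codim_anti {V W : Submodule ℂ K} (hV : F.Inv V) (hW : F.Inv W) (h : V ≤ W) :
    F.codim W ≤ F.codim V :=
  F.map_mono hW.orthogonal.starProjection_mem hV.orthogonal.starProjection_mem
    (Submodule.starProjection_le_starProjection_iff.2 (Submodule.orthogonal_le h))

theorem codim_nonneg {V : Submodule ℂ K} (hV : F.Inv V) : 0 ≤ F.codim V :=
  F.map_nonneg hV.orthogonal.starProjection_mem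
    (isStarProjection_starProjection.nonneg)

theorem dense_of_codim_eq_zero {V : Submodule ℂ K} (hV : F.Inv V) (h : F.codim V = 0) :
    Dense (V : Set K) := by
  have hp : IsStarProjection Vᗮ.starProjection := isStarProjection_starProjection
  have h0 := F.faithful _ hV.orthogonal.starProjection_mem
    (by rw [hp.isSelfAdjoint.star_eq, hp.isIdempotentElem.eq]; exact h)
  rw [Submodule.dense_iff_topologicalClosure_eq_top, Submodule.topologicalClosure_eq_top_iff]
  rw [eq_bot_iff]
  intro x hx
  have := Submodule.starProjection_eq_self_iff.2 hx
  rw [h0] at this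
  simpa using this.symm

theorem starProjection_orthogonal_orthogonal (V : Submodule ℂ K) :
    Vᗮᗮ.starProjection = 1 - Vᗮ.starProjection :=
  Submodule.starProjection_orthogonal' _

theorem codim_orthogonal {V : Submodule ℂ K} (hV : F.Inv V) :
    F.codim Vᗮ = F.t 1 - F.codim V := by
  rw [codim, starProjection_orthogonal_orthogonal,
    F.map_sub (one_mem _) hV.orthogonal.starProjection_mem, codim]

theorem codim_tendsto_zero {V : ℕ → Submodule ℂ K} (hV : ∀ n, F.Inv (V n)) (hm : Monotone V)
    (hd : Dense (⋃ n, (V n : Set K))) : Tendsto (fun n => F.codim (V n)) atTop (𝓝 0) := by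
  have key : Tendsto (fun n => F.t (1 - (V n)ᗮ.starProjection)) atTop (𝓝 (F.t 1)) := by
    refine F.normal _ _ (fun n => sub_mem (one_mem _) (hV n).orthogonal.starProjection_mem)
      (fun n => (IsSelfAdjoint.one _).sub isStarProjection_starProjection.isSelfAdjoint)
      (fun m n hmn => sub_le_sub_left (Submodule.starProjection_le_starProjection_iff.2
        (Submodule.orthogonal_le (hm hmn))) _) (fun ξ => ?_)
    rw [Metric.tendsto_atTop]
    intro ε hε
    obtain ⟨v, hv, hvε⟩ := Metric.dense_iff.1 hd ξ ε hε
    obtain ⟨N, hN⟩ := Set.mem_iUnion.1 hvε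
    refine ⟨N, fun n hn => ?_⟩
    have h0 : (V n)ᗮ.starProjection v = 0 :=
      Submodule.starProjection_orthogonal_apply_eq_zero (hm hn hN)
    have h1 : dist ((1 - (V n)ᗮ.starProjection) ξ) ((1 : K →L[ℂ] K) ξ)
        = ‖(V n)ᗮ.starProjection (v - ξ)‖ := by
      rw [dist_eq_norm, _root_.map_sub, h0]
      congr 1
      simp
    rw [h1]
    refine (Submodule.norm_starProjection_apply_le _ _).trans_lt ?_
    rwa [← dist_eq_norm]
  have h2 := (tendsto_const_nhds (x := F.t 1)).sub key
  rw [sub_self] at h2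
  refine h2.congr fun n => ?_
  rw [F.map_sub (one_mem _) (hV n).orthogonal.starProjection_mem, codim]
  ring

end TraceData

end

noncomputable section

section Resolvent

variable {K : Type*} [NormedAddCommGroup K] [InnerProductSpace ℂ K] [CompleteSpace K]

/-- The functional calculus `Z ↦ (Z + s)⁻¹`. -/
def posResolvent (s : ℝ) (Z : K →L[ℂ] K) : K →L[ℂ] K := cfc (fun t : ℝ => (t + s)⁻¹) Z

/-- The functional calculus `Z ↦ Z (Z + s)⁻¹`. -/
def softSupport (s : ℝ) (Z : K →L[ℂ] K) : K →L[ℂ] K := cfc (fun t : ℝ => t * (t + s)⁻¹) Z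

variable {Z : K →L[ℂ] K} (hZ : 0 ≤ Z) {s : ℝ} (hs : 0 < s)

include hZ hs

theorem continuousOn_posResolvent :
    ContinuousOn (fun t : ℝ => (t + s)⁻¹) (spectrum ℝ Z) := by
  refine ContinuousOn.inv₀ (by fun_prop) fun t ht => ?_
  have := spectrum_nonneg_of_nonneg hZ ht
  positivity

theorem softSupport_eq_mul : softSupport s Z = posResolvent s Z * Z := by
  have hsa : IsSelfAdjoint Z := .of_nonneg hZ
  have hc := continuousOn_posResolvent hZ hs
  rw [softSupport, cfc_mul (fun t : ℝ => t) _ Z, cfc_id' ℝ Z, ← posResolvent]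
  exact (((Commute.refl Z).cfc_real (fun t : ℝ => (t + s)⁻¹))).eq.symm

theorem posResolvent_mul : posResolvent s Z * (Z + s • 1) = 1 := by
  have hsa : IsSelfAdjoint Z := .of_nonneg hZ
  have hc := continuousOn_posResolvent hZ hs
  have h1 : Z + s • 1 = cfc (fun t : ℝ => t + s) Z := by
    rw [cfc_add_const s (fun t : ℝ => t) Z, cfc_id' ℝ Z, Algebra.algebraMap_eq_smul_one]
  rw [h1, posResolvent, ← cfc_mul _ _ Z, ← cfc_one ℝ Z]
  refine cfc_congr fun t ht => ?_
  have := spectrum_nonneg_of_nonneg hZ ht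
  have h2 : t + s ≠ 0 := by positivity
  simp [h2]

theorem mul_posResolvent : (Z + s • 1) * posResolvent s Z = 1 := by
  have hsa : IsSelfAdjoint Z := .of_nonneg hZ
  have : Commute (posResolvent s Z) Z := (Commute.refl Z).cfc_real (fun t : ℝ => (t + s)⁻¹)
  have h := posResolvent_mul hZ hs
  rw [mul_add, this.eq] at h
  rw [add_mul]
  refine Eq.trans ?_ h
  simp

theorem softSupport_le_one : softSupport s Z ≤ 1 := by
  refine cfc_le_one _ _ fun t ht => ?_
  have := spectrum_nonneg_of_nonneg hZ ht
  rw [← div_eq_mul_inv]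
  exact div_le_one_of_le₀ (by linarith) (by positivity)

theorem norm_softSupport_le : ‖softSupport s Z‖ ≤ 1 := by
  refine norm_cfc_le zero_le_one fun t ht => ?_
  have := spectrum_nonneg_of_nonneg hZ ht
  rw [Real.norm_of_nonneg (by positivity), ← div_eq_mul_inv]
  exact div_le_one_of_le₀ (by linarith) (by positivity)

theorem softSupport_anti {r : ℝ} (hr : s ≤ r) : softSupport r Z ≤ softSupport s Z := by
  have hsa : IsSelfAdjoint Z := .of_nonneg hZ
  have hc := continuousOn_posResolvent hZ hs
  have hc' := continuousOn_posResolvent hZ (hs.trans_le hr)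
  refine cfc_mono (fun t ht => ?_) (by fun_prop) (by fun_prop)
  have := spectrum_nonneg_of_nonneg hZ ht
  gcongr

theorem sub_softSupport_mul : Z - softSupport s Z * Z = s • softSupport s Z := by
  rw [softSupport_eq_mul hZ hs]
  have := posResolvent_mul hZ hs
  calc _ = (1 - posResolvent s Z * Z) * Z := by rw [sub_mul, one_mul]
    _ = (s • posResolvent s Z) * Z := by
      rw [← this]; simp [mul_add]
    _ = _ := smul_mul_assoc _ _ _

omit hs hZ

theorem mul_posResolvent_comm (Y : K →L[ℂ] K) (hs : 0 < s) :
    Y * posResolvent s (star Y * Y) = posResolvent s (Y * star Y) * Y := by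
  have h1 := mul_posResolvent (star_mul_self_nonneg Y) hs
  have h2 := posResolvent_mul (mul_star_self_nonneg Y) hs
  calc _ = posResolvent s (Y * star Y) * ((Y * star Y + s • 1) * Y) *
        posResolvent s (star Y * Y) := by
        rw [← mul_assoc (posResolvent s (Y * star Y)), h2, one_mul]
    _ = posResolvent s (Y * star Y) * (Y * ((star Y * Y + s • 1)) *
        posResolvent s (star Y * Y)) := by
        simp only [mul_add, add_mul, mul_assoc, smul_mul_assoc, mul_smul_comm, one_mul, mul_one]
    _ = _ := by rw [mul_assoc Y, h1, mul_one]

theorem tendsto_softSupport (Y : K →L[ℂ] K) (ξ : K) :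
    Tendsto (fun n : ℕ => softSupport (1 / ((n : ℝ) + 1)) (star Y * Y) ξ) atTop
      (𝓝 ((LinearMap.ker Y.toLinearMap)ᗮ.starProjection ξ)) := by
  set Z := star Y * Y with hZd
  have hZ : 0 ≤ Z := star_mul_self_nonneg Y
  have hsa : IsSelfAdjoint Z := .of_nonneg hZ
  set P := (LinearMap.ker Y.toLinearMap)ᗮ.starProjection with hP
  set S := fun n : ℕ => softSupport (1 / ((n : ℝ) + 1)) Z with hS
  have hpos : ∀ n : ℕ, 0 < 1 / ((n : ℝ) + 1) := fun n => by positivity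
  have hker : ∀ x, Y x = 0 → ∀ n, S n x = 0 := by
    intro x hx n
    simp only [hS]
    rw [softSupport_eq_mul hZ (hpos n), hZd]
    simp [hx]
  have hle : (LinearMap.ker Y.toLinearMap)ᗮ ≤
      (LinearMap.range Z.toLinearMap).topologicalClosure := by
    rw [← Submodule.orthogonal_orthogonal_eq_closure]
    refine Submodule.orthogonal_le fun x hx => ?_
    have hx' : ⟪Z (x), x⟫_ℂ = 0 := (Submodule.mem_orthogonal _ _).1 hx _ ⟨x, rfl⟩
    rw [hZd, mul_apply_eq_comp, ContinuousLinearMap.star_eq_adjoint,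
      ContinuousLinearMap.adjoint_inner_left, inner_self_eq_zero] at hx'
    exact hx'
  have hrange : ∀ η ∈ (LinearMap.range Z.toLinearMap).topologicalClosure,
      Tendsto (fun n => S n η) atTop (𝓝 η) := by
    intro η hη
    rw [Metric.tendsto_atTop]
    intro ε hε
    obtain ⟨_, ⟨ζ, rfl⟩, hvε⟩ := Metric.mem_closure_iff.1 hη (ε / 3) (by positivity)
    have h0 : Tendsto (fun n : ℕ => 1 / ((n : ℝ) + 1) * ‖ζ‖) atTop (𝓝 0) := by
      simpa using tendsto_one_div_add_atTop_nhds_zero_nat.mul_const ‖ζ‖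
    obtain ⟨N, hN⟩ := (h0.eventually
      (gt_mem_nhds (show 0 < ε / 3 by positivity))).exists_forall_of_atTop
    refine ⟨N, fun n hn => ?_⟩
    have h1 : ‖S n (η - Z ζ)‖ ≤ ‖η - Z ζ‖ :=
      (S n).le_of_opNorm_le (norm_softSupport_le hZ (hpos n)) _ |>.trans_eq (one_mul _)
    have h2 : ‖Z ζ - S n (Z ζ)‖ ≤ 1 / ((n : ℝ) + 1) * ‖ζ‖ := by
      have := congrArg (· ζ) (sub_softSupport_mul hZ (hpos n))
      simp only [sub_apply, mul_apply_eq_comp] at this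
      rw [this, smul_apply, norm_smul, Real.norm_of_nonneg (hpos n).le]
      gcongr
      exact (S n).le_of_opNorm_le (norm_softSupport_le hZ (hpos n)) _ |>.trans_eq (one_mul _)
    have h3 : ‖η - Z ζ‖ < ε / 3 := by rw [← dist_eq_norm]; exact hvε
    rw [dist_eq_norm]
    calc ‖S n η - η‖ = ‖S n (η - Z ζ) - (Z ζ - S n (Z ζ)) - (η - Z ζ)‖ := by
          rw [_root_.map_sub]; congr 1; abel
      _ ≤ ‖S n (η - Z ζ)‖ + ‖Z ζ - S n (Z ζ)‖ + ‖η - Z ζ‖ :=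
          (norm_sub_le _ _).trans (add_le_add_left (norm_sub_le _ _) _)
      _ < ε := by have := hN n hn; linarith
  refine (hrange (P ξ) (hle (Submodule.starProjection_apply_mem _ _))).congr fun n => ?_
  have h5 : ξ - P ξ ∈ LinearMap.ker Y.toLinearMap := by
    have h6 := Submodule.sub_starProjection_mem_orthogonal (K := (LinearMap.ker Y.toLinearMap)ᗮ) ξ
    have hc : IsClosed (LinearMap.ker Y.toLinearMap : Set K) := Y.isClosed_ker
    rwa [Submodule.orthogonal_orthogonal_eq_closure, hc.submodule_topologicalClosure_eq] at h6
  have := hker _ h5 n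
  rw [_root_.map_sub, sub_eq_zero] at this
  exact this.symm

end Resolvent

namespace TraceData

variable {K : Type*} [NormedAddCommGroup K] [InnerProductSpace ℂ K] [CompleteSpace K]
  {F : TraceData K}

theorem softSupport_trace {Y : K →L[ℂ] K} (hY : Y ∈ F.alg) {s : ℝ} (hs : 0 < s) :
    F.t (softSupport s (star Y * Y)) ≤ F.t ((LinearMap.range Y.toLinearMap)ᗮᗮ.starProjection) := by
  have hZ' := mul_star_self_nonneg Y
  have hG : posResolvent s (star Y * Y) ∈ F.alg := F.cfc_mem (mul_mem (star_mem hY) hY) _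
  set R := (LinearMap.range Y.toLinearMap)ᗮᗮ.starProjection with hR
  have hRp : IsStarProjection R := isStarProjection_starProjection
  have hRY : R * Y = Y := by
    ext x
    exact Submodule.starProjection_eq_self_iff.2
      (Submodule.le_orthogonal_orthogonal _ ⟨x, rfl⟩)
  have hRY' : star Y * R = star Y := by
    conv_rhs => rw [← hRY, star_mul, hRp.isSelfAdjoint.star_eq]
  have h1 : F.t (softSupport s (star Y * Y)) = F.t (softSupport s (Y * star Y)) := by
    rw [softSupport_eq_mul (_root_.star_mul_self_nonneg Y) hs, softSupport_eq_mul hZ' hs,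
      ← mul_assoc,
      F.map_mul_comm _ (mul_mem hG (star_mem hY)) _ hY, ← mul_assoc, ← mul_assoc,
      mul_posResolvent_comm Y hs]
  rw [h1]
  refine F.map_mono (F.cfc_mem (mul_mem hY (star_mem hY)) _)
    ((inv_range hY).orthogonal.orthogonal.starProjection_mem) ?_
  have hS : softSupport s (Y * star Y) * R = softSupport s (Y * star Y) := by
    rw [softSupport_eq_mul hZ' hs, mul_assoc, mul_assoc, hRY']
  have hsa : IsSelfAdjoint (softSupport s (Y * star Y)) := cfc_predicate _ _
  have hS' : R * softSupport s (Y * star Y) = softSupport s (Y * star Y) := by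
    have := congrArg star hS
    rwa [star_mul, hsa.star_eq, hRp.isSelfAdjoint.star_eq] at this
  have := star_left_conjugate_le_conjugate (softSupport_le_one hZ' hs) R
  rwa [hRp.isSelfAdjoint.star_eq, hS', hS, mul_one, hRp.isIdempotentElem.eq] at this

/-- Rank-nullity. -/
theorem codim_ker_add_codim_range_le {Y : K →L[ℂ] K} (hY : Y ∈ F.alg) :
    F.codim (LinearMap.ker Y.toLinearMap) + F.codim (LinearMap.range Y.toLinearMap) ≤ F.t 1 := by
  have hlim : Tendsto (fun n : ℕ => F.t (softSupport (1 / ((n : ℝ) + 1)) (star Y * Y))) atTop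
      (𝓝 (F.codim (LinearMap.ker Y.toLinearMap))) := by
    refine F.normal _ _ (fun n => F.cfc_mem (mul_mem (star_mem hY) hY) _)
      (fun n => cfc_predicate _ _) (fun m n hmn => ?_) (tendsto_softSupport Y)
    refine softSupport_anti (_root_.star_mul_self_nonneg Y) (by positivity) ?_
    exact one_div_le_one_div_of_le (by positivity) (by gcongr)
  have := le_of_tendsto' hlim fun n => softSupport_trace hY (by positivity)
  have h2 := codim_orthogonal (inv_range hY)
  rw [codim] at h2
  linarith

theorem codim_inf_of_orthogonal_le {V U : Submodule ℂ K} (hVi : F.Inv V) (hUi : F.Inv U)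
    (hV : IsClosed (V : Set K)) (hU : IsClosed (U : Set K)) (h : Vᗮ ≤ U) :
    F.codim (V ⊓ U) = F.codim V + F.codim U := by
  have hVV : Vᗮᗮ = V := by
    rw [Submodule.orthogonal_orthogonal_eq_closure, hV.submodule_topologicalClosure_eq]
  have hUU : Uᗮᗮ = U := by
    rw [Submodule.orthogonal_orthogonal_eq_closure, hU.submodule_topologicalClosure_eq]
  have h' : Uᗮ ≤ V := (Submodule.orthogonal_le h).trans_eq hVV
  have key : (V ⊓ U)ᗮ.starProjection = Vᗮ.starProjection + Uᗮ.starProjection := by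
    ext x
    apply Submodule.eq_starProjection_of_mem_orthogonal
    · exact Submodule.add_mem _
        (Submodule.orthogonal_le inf_le_left (Submodule.starProjection_apply_mem _ _))
        (Submodule.orthogonal_le inf_le_right (Submodule.starProjection_apply_mem _ _))
    · refine Submodule.le_orthogonal_orthogonal _ ⟨?_, ?_⟩
      · have h1 : x - Vᗮ.starProjection x ∈ Vᗮᗮ :=
          Submodule.sub_starProjection_mem_orthogonal x
        rw [hVV] at h1
        have := V.sub_mem h1 (h' (Submodule.starProjection_apply_mem Uᗮ x))
        rwa [sub_sub] at this
      · have h1 : x - Uᗮ.starProjection x ∈ Uᗮᗮ :=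
          Submodule.sub_starProjection_mem_orthogonal x
        rw [hUU] at h1
        have := U.sub_mem h1 (h (Submodule.starProjection_apply_mem Vᗮ x))
        rwa [sub_sub, add_comm] at this
  rw [codim, key, F.map_add _ hVi.orthogonal.starProjection_mem _
    hUi.orthogonal.starProjection_mem, codim, codim]

theorem codim_inf_le {V W : Submodule ℂ K} (hVi : F.Inv V) (hWi : F.Inv W)
    (hV : IsClosed (V : Set K)) (hW : IsClosed (W : Set K)) :
    F.codim (V ⊓ W) ≤ F.codim V + F.codim W := by
  have : CompleteSpace V := hV.completeSpace_coe
  set Y := Wᗮ.starProjection * V.starProjection with hY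
  have hYm : Y ∈ F.alg := mul_mem hWi.orthogonal.starProjection_mem hVi.starProjection_mem
  have hWW : Wᗮᗮ = W := by
    rw [Submodule.orthogonal_orthogonal_eq_closure, hW.submodule_topologicalClosure_eq]
  have h1 : V ⊓ W = V ⊓ LinearMap.ker Y.toLinearMap := by
    ext x
    simp only [Submodule.mem_inf, LinearMap.mem_ker, and_congr_right_iff]
    intro hx
    have : Y x = Wᗮ.starProjection x := by
      rw [hY, mul_apply_eq_comp, Submodule.starProjection_eq_self_iff.2 hx]
    change _ ↔ Y x = 0
    rw [this, Submodule.starProjection_apply_eq_zero_iff, hWW]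
  have h2 : Vᗮ ≤ LinearMap.ker Y.toLinearMap := by
    intro x hx
    change Y x = 0
    rw [hY, mul_apply_eq_comp, (Submodule.starProjection_apply_eq_zero_iff _).2 hx, _root_.map_zero]
  rw [h1, codim_inf_of_orthogonal_le hVi (inv_ker hYm) hV Y.isClosed_ker h2]
  have h3 := codim_ker_add_codim_range_le hYm
  have h4 : LinearMap.range Y.toLinearMap ≤ Wᗮ := by
    rintro _ ⟨x, rfl⟩
    exact Submodule.starProjection_apply_mem _ _
  have h5 := codim_anti (inv_range hYm) hWi.orthogonal h4
  rw [codim_orthogonal hWi] at h5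
  linarith

theorem codim_map_le {V : Submodule ℂ K} (hVi : F.Inv V)
    {Y : K →L[ℂ] K} (hY : Y ∈ F.alg) (hker : LinearMap.ker Y.toLinearMap ≤ Vᗮ) :
    F.codim (LinearMap.range Y.toLinearMap) ≤ F.codim V := by
  have h1 := codim_ker_add_codim_range_le hY
  have h2 := codim_anti (inv_ker hY) hVi.orthogonal hker
  rw [codim_orthogonal hVi] at h2
  linarith

end TraceData

end

noncomputable section

variable {H : Type*} [NormedAddCommGroup H] [InnerProductSpace ℂ H] [CompleteSpace H]

namespace ProjectionValuedMeasure

variable (E : ProjectionValuedMeasure H)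

theorem scalarMeasure_apply (ξ : H) {S : Set ℝ} (hS : MeasurableSet S) :
    E.scalarMeasure ξ S = ENNReal.ofReal (‖E.proj S ξ‖ ^ 2) := by
  rw [scalarMeasure, Measure.ofMeasurable_apply _ hS, E.re_inner_eq hS]

theorem scalarMeasure_univ (ξ : H) : E.scalarMeasure ξ Set.univ = ENNReal.ofReal (‖ξ‖ ^ 2) := by
  rw [E.scalarMeasure_apply ξ .univ, E.proj_univ, one_apply_eq_self]

instance (ξ : H) : IsFiniteMeasure (E.scalarMeasure ξ) :=
  ⟨by rw [E.scalarMeasure_univ]; exact ENNReal.ofReal_lt_top⟩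

theorem proj_add_compl {S : Set ℝ} (hS : MeasurableSet S) : E.proj S + E.proj Sᶜ = 1 := by
  ext ξ
  let f : ℕ → Set ℝ := fun n => if n = 0 then S else if n = 1 then Sᶜ else ∅
  have h := E.hasSum_iUnion f (fun n => by simp only [f]; split_ifs <;> simp [hS])
    (fun m n hmn => by
      simp only [f]
      split_ifs <;> first | omega | simp [disjoint_compl_right, disjoint_compl_left]) ξ
  have h1 : ⋃ n, f n = Set.univ := by
    ext t
    simp only [Set.mem_iUnion, Set.mem_univ, iff_true]
    by_cases ht : t ∈ S
    · exact ⟨0, by simpa [f] using ht⟩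
    · exact ⟨1, by simpa [f] using ht⟩
  have h2 : HasSum (fun n => E.proj (f n) ξ) (∑ n ∈ Finset.range 2, E.proj (f n) ξ) :=
    hasSum_sum_of_ne_finset_zero fun n hn => by
      simp only [Finset.mem_range, not_lt] at hn
      simp [f, E.proj_empty, show n ≠ 0 by omega, show n ≠ 1 by omega]
  have := h2.unique h
  rw [h1, E.proj_univ] at this
  simpa [Finset.sum_range_succ, f] using this

/-- The range of a spectral projection. -/
def subspace (S : Set ℝ) : Submodule ℂ H := LinearMap.ker (1 - E.proj S : H →L[ℂ] H).toLinearMap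

variable {E}

theorem mem_subspace {S : Set ℝ} {ξ : H} : ξ ∈ E.subspace S ↔ E.proj S ξ = ξ := by
  change (1 - E.proj S : H →L[ℂ] H) ξ = 0 ↔ _
  rw [sub_apply, one_apply_eq_self, sub_eq_zero, eq_comm]

variable (E)

theorem isClosed_subspace (S : Set ℝ) : IsClosed (E.subspace S : Set H) :=
  (1 - E.proj S : H →L[ℂ] H).isClosed_ker

theorem proj_mem_subspace {S : Set ℝ} (hS : MeasurableSet S) (ξ : H) :
    E.proj S ξ ∈ E.subspace S := by
  rw [mem_subspace, ← mul_apply_eq_comp, (E.isStarProjection S hS).isIdempotentElem.eq]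

theorem subspace_mono {S T : Set ℝ} (hS : MeasurableSet S) (hT : MeasurableSet T) (h : S ⊆ T) :
    E.subspace S ≤ E.subspace T := by
  intro ξ hξ
  rw [mem_subspace] at hξ ⊢
  conv_lhs => rw [← hξ]
  rw [← mul_apply_eq_comp, ← E.proj_inter T S hT hS, Set.inter_eq_right.2 h, hξ]

theorem starProjection_orthogonal_subspace {S : Set ℝ} (hS : MeasurableSet S) :
    (E.subspace S)ᗮ.starProjection = E.proj Sᶜ := by
  ext ξ
  have hc := E.proj_add_compl hS
  have h0 : ∀ x, E.proj S x + E.proj Sᶜ x = x := fun x => congrArg (· x) hc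
  have h1 : ∀ x, E.proj S (E.proj Sᶜ x) = 0 := fun x => by
    rw [← mul_apply_eq_comp, ← E.proj_inter _ _ hS hS.compl, Set.inter_compl_self, E.proj_empty]
    simp
  apply Submodule.eq_starProjection_of_mem_orthogonal
  · rw [Submodule.mem_orthogonal]
    intro u hu
    rw [mem_subspace] at hu
    rw [← hu, ← ContinuousLinearMap.adjoint_inner_right, ← ContinuousLinearMap.star_eq_adjoint,
      (E.isStarProjection S hS).isSelfAdjoint.star_eq, h1, inner_zero_right]
  · apply Submodule.le_orthogonal_orthogonal
    have : ξ - E.proj Sᶜ ξ = E.proj S ξ := by rw [sub_eq_iff_eq_add, h0]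
    rw [this]
    exact E.proj_mem_subspace hS ξ

theorem dense_iUnion_subspace :
    Dense (⋃ n : ℕ, (E.subspace (Set.Icc (-(n : ℝ)) n) : Set H)) := by
  have hm : ∀ n : ℕ, MeasurableSet (Set.Icc (-(n : ℝ)) n) := fun n => measurableSet_Icc
  intro ξ
  have h1 : Tendsto (fun n : ℕ => E.scalarMeasure ξ (Set.Icc (-(n : ℝ)) n)ᶜ) atTop (𝓝 0) := by
    have h2 : ⋂ n : ℕ, (Set.Icc (-(n : ℝ)) n)ᶜ = ∅ := by
      rw [← Set.compl_iUnion, Set.compl_empty_iff]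
      ext t
      obtain ⟨n, hn⟩ := exists_nat_ge |t|
      simpa using ⟨n, abs_le.1 hn⟩
    have := tendsto_measure_iInter_atTop (μ := E.scalarMeasure ξ)
      (fun n => (hm n).compl.nullMeasurableSet)
      (fun m n hmn => Set.compl_subset_compl.2 (Set.Icc_subset_Icc
        (neg_le_neg (Nat.cast_le.2 hmn)) (Nat.cast_le.2 hmn))) ⟨0, measure_ne_top _ _⟩
    rwa [h2, measure_empty] at this
  have h3 : Tendsto (fun n : ℕ => ‖E.proj (Set.Icc (-(n : ℝ)) n)ᶜ ξ‖) atTop (𝓝 0) := by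
    have h4 := (ENNReal.tendsto_toReal ENNReal.zero_ne_top).comp h1
    have h5 := (Real.continuous_sqrt.tendsto _).comp h4
    simp only [ENNReal.toReal_zero, Real.sqrt_zero] at h5
    refine h5.congr fun n => ?_
    simp only [Function.comp_apply]
    rw [E.scalarMeasure_apply _ (hm n).compl, ENNReal.toReal_ofReal (by positivity),
      Real.sqrt_sq (norm_nonneg _)]
  have h6 : Tendsto (fun n : ℕ => E.proj (Set.Icc (-(n : ℝ)) n) ξ) atTop (𝓝 ξ) := by
    rw [tendsto_iff_norm_sub_tendsto_zero]
    refine h3.congr fun n => ?_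
    have := congrArg (· ξ) (E.proj_add_compl (hm n))
    simp only [add_apply, one_apply_eq_self] at this
    rw [← norm_neg]
    congr 1
    rw [neg_eq_iff_add_eq_zero, add_sub, add_comm, this, sub_self]
  exact mem_closure_of_tendsto h6 (Eventually.of_forall fun n =>
    Set.mem_iUnion.2 ⟨n, E.proj_mem_subspace (hm n) ξ⟩)

theorem ae_mem_of_mem_subspace {S : Set ℝ} (hS : MeasurableSet S) {ξ : H} (hξ : ξ ∈ E.subspace S) :
    ∀ᵐ t ∂(E.scalarMeasure ξ), t ∈ S := by
  rw [ae_iff]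
  change E.scalarMeasure ξ Sᶜ = 0
  rw [E.scalarMeasure_apply _ hS.compl]
  have := congrArg (· ξ) (E.proj_add_compl hS)
  simp only [add_apply, one_apply_eq_self, ProjectionValuedMeasure.mem_subspace.1 hξ,
    add_eq_left] at this
  simp [this]

theorem abs_integral_le {r : ℝ} {ξ : H} (hξ : ξ ∈ E.subspace (Set.Icc (-r) r)) :
    |∫ t, t ∂(E.scalarMeasure ξ)| ≤ r * ‖ξ‖ ^ 2 := by
  have h := norm_integral_le_of_norm_le_const (μ := E.scalarMeasure ξ) (f := fun t : ℝ => t)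
    (C := r) ((E.ae_mem_of_mem_subspace measurableSet_Icc hξ).mono fun t ht => abs_le.2 ht)
  rwa [Measure.real, E.scalarMeasure_univ, ENNReal.toReal_ofReal (by positivity)] at h

end ProjectionValuedMeasure

theorem isFormalAdjoint_self {a : H →ₗ.[ℂ] H} (ha : IsSelfAdjoint a) (ξ η : a.domain) :
    ⟪a ξ, (η : H)⟫_ℂ = ⟪(ξ : H), a η⟫_ℂ := by
  have := LinearPMap.adjoint_isFormalAdjoint ha.dense_domain
  rw [LinearPMap.isSelfAdjoint_def.1 ha] at this
  exact this ξ η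

namespace IsSpectralMeasure

variable {a : H →ₗ.[ℂ] H} {E : ProjectionValuedMeasure H} (hE : IsSpectralMeasure a E)

include hE

theorem integrable {ξ : H} (hξ : ξ ∈ a.domain) :
    Integrable (fun t : ℝ => t) (E.scalarMeasure ξ) := by
  have h := (hE.mem_domain_iff ξ).1 hξ
  have h2 : Integrable (fun t : ℝ => t ^ 2) (E.scalarMeasure ξ) :=
    (lintegral_ofReal_ne_top_iff_integrable (by fun_prop)
      (Eventually.of_forall fun t => sq_nonneg t)).1 h.ne
  refine (h2.add (integrable_const 1)).mono (by fun_prop) (Eventually.of_forall fun t => ?_)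
  simp only [Pi.add_apply, Real.norm_eq_abs]
  rw [abs_of_nonneg (by positivity : 0 ≤ t ^ 2 + 1)]
  nlinarith [sq_nonneg (|t| - 1), sq_abs t, abs_nonneg t]

theorem re_inner_eq (ha : IsSelfAdjoint a) (ξ η : a.domain) :
    4 * (⟪(η : H), a ξ⟫_ℂ).re = ∫ t, t ∂(E.scalarMeasure ((ξ : H) + η)) -
      ∫ t, t ∂(E.scalarMeasure ((ξ : H) - η)) := by
  have h1 := congrArg Complex.re (hE.inner_apply (ξ + η))
  have h2 := congrArg Complex.re (hE.inner_apply (ξ - η))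
  have h3 := congrArg Complex.re (isFormalAdjoint_self ha ξ η)
  have h4 : (⟪a ξ, (η : H)⟫_ℂ).re = (⟪(η : H), a ξ⟫_ℂ).re := by
    rw [← inner_conj_symm, Complex.conj_re]
  simp only [Submodule.coe_add, Submodule.coe_sub, LinearPMap.map_add, LinearPMap.map_sub,
    inner_add_left, inner_add_right, inner_sub_left, inner_sub_right, Complex.add_re,
    Complex.sub_re, Complex.ofReal_re] at h1 h2
  linarith

theorem mem_domain_of_commute {y : H →L[ℂ] H}
    (hy : ∀ S, MeasurableSet S → Commute y (E.proj S)) {ξ : H} (hξ : ξ ∈ a.domain) :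
    y ξ ∈ a.domain := by
  rw [hE.mem_domain_iff] at hξ ⊢
  have h : E.scalarMeasure (y ξ) ≤ ENNReal.ofReal (‖y‖ ^ 2) • E.scalarMeasure ξ := by
    refine Measure.le_iff.2 fun S hS => ?_
    rw [Measure.smul_apply, E.scalarMeasure_apply _ hS, E.scalarMeasure_apply _ hS, smul_eq_mul,
      ← ENNReal.ofReal_mul (by positivity), ← mul_pow]
    have : E.proj S (y ξ) = y (E.proj S ξ) := (congrArg (· ξ) (hy S hS).eq).symm
    rw [this]
    gcongr
    exact y.le_opNorm _
  refine (lintegral_mono' h le_rfl).trans_lt ?_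
  rw [lintegral_smul_measure]
  exact ENNReal.mul_lt_top ENNReal.ofReal_lt_top hξ

theorem re_inner_commute (ha : IsSelfAdjoint a) {y : H →L[ℂ] H}
    (hy : ∀ S, MeasurableSet S → Commute y (E.proj S)) (ξ η : a.domain)
    (hyξ : y ξ ∈ a.domain) :
    (⟪(η : H), a ⟨y ξ, hyξ⟩⟫_ℂ).re = (⟪(η : H), y (a ξ)⟫_ℂ).re := by
  have hy' : ∀ S, MeasurableSet S → Commute (star y) (E.proj S) := fun S hS => by
    have := (hy S hS).star_star
    rwa [(E.isStarProjection S hS).isSelfAdjoint.star_eq] at this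
  have hη := hE.mem_domain_of_commute hy' η.2
  have h1 := hE.re_inner_eq ha ⟨y ξ, hyξ⟩ η
  have h2 := hE.re_inner_eq ha ξ ⟨star y η, hη⟩
  have h3 : E.scalarMeasure (y ξ + η) + E.scalarMeasure ((ξ : H) - star y (η : H)) =
      E.scalarMeasure (y ξ - η) + E.scalarMeasure ((ξ : H) + star y (η : H)) := by
    refine Measure.ext fun S hS => ?_
    simp only [Measure.add_apply, E.scalarMeasure_apply _ hS]
    rw [← ENNReal.ofReal_add (by positivity) (by positivity),
      ← ENNReal.ofReal_add (by positivity) (by positivity)]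
    congr 1
    have e1 : E.proj S (y ξ) = y (E.proj S ξ) := (congrArg (· (ξ : H)) (hy S hS).eq).symm
    have e2 : E.proj S (star y (η : H)) = star y (E.proj S η) :=
      (congrArg (· (η : H)) (hy' S hS).eq).symm
    simp only [_root_.map_add, _root_.map_sub, e1, e2]
    have e3 : ⟪E.proj S ξ, star y (E.proj S η)⟫_ℂ = ⟪y (E.proj S ξ), E.proj S η⟫_ℂ := by
      rw [ContinuousLinearMap.star_eq_adjoint, ContinuousLinearMap.adjoint_inner_right]
    rw [@norm_add_sq ℂ, @norm_add_sq ℂ, @norm_sub_sq ℂ, @norm_sub_sq ℂ, e3]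
    ring
  have i1 := hE.integrable (a.domain.add_mem hyξ η.2)
  have i2 := hE.integrable (a.domain.sub_mem hyξ η.2)
  have i3 := hE.integrable (a.domain.add_mem ξ.2 hη)
  have i4 := hE.integrable (a.domain.sub_mem ξ.2 hη)
  have h4 := congrArg (fun μ : Measure ℝ => ∫ t, t ∂μ) h3
  simp only [integral_add_measure i1 i4, integral_add_measure i2 i3] at h4
  have h5 : ⟪star y (η : H), a ξ⟫_ℂ = ⟪(η : H), y (a ξ)⟫_ℂ := by
    rw [ContinuousLinearMap.star_eq_adjoint, ContinuousLinearMap.adjoint_inner_left]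
  rw [← h5]
  simp only at h1 h2
  linarith

/-- A bounded operator commuting with the spectral projections commutes with the operator. -/
theorem graph_commute (ha : IsSelfAdjoint a) {y : H →L[ℂ] H}
    (hy : ∀ S, MeasurableSet S → Commute y (E.proj S)) {ξ ζ : H} (h : (ξ, ζ) ∈ a.graph) :
    (y ξ, y ζ) ∈ a.graph := by
  obtain ⟨ξ', rfl, rfl⟩ := LinearPMap.mem_graph_iff _ |>.1 h
  have hyξ := hE.mem_domain_of_commute hy ξ'.2
  rw [LinearPMap.mem_graph_iff]
  refine ⟨⟨y ξ', hyξ⟩, rfl, ?_⟩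
  refine ha.dense_domain.eq_of_inner_right ℂ fun η hη => ?_
  apply Complex.ext
  · exact hE.re_inner_commute ha hy ξ' ⟨η, hη⟩ hyξ
  · have := hE.re_inner_commute ha hy ξ' (Complex.I • ⟨η, hη⟩) hyξ
    simpa [inner_smul_left] using this

theorem subspace_le_domain (r : ℝ) : E.subspace (Set.Icc (-r) r) ≤ a.domain := by
  intro ξ hξ
  rw [hE.mem_domain_iff]
  have h := E.ae_mem_of_mem_subspace measurableSet_Icc hξ
  calc _ ≤ ∫⁻ t, ENNReal.ofReal (r ^ 2) ∂(E.scalarMeasure ξ) := by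
        refine lintegral_mono_ae (h.mono fun t ht => ENNReal.ofReal_le_ofReal ?_)
        exact sq_le_sq' ht.1 ht.2
    _ < ⊤ := by
        rw [lintegral_const]
        exact ENNReal.mul_lt_top ENNReal.ofReal_lt_top (measure_lt_top _ _)

theorem apply_mem_subspace (ha : IsSelfAdjoint a) {S : Set ℝ} (hS : MeasurableSet S)
    {ξ : a.domain} (hξ : (ξ : H) ∈ E.subspace S) : a ξ ∈ E.subspace S := by
  have hc : ∀ T, MeasurableSet T → Commute (E.proj S) (E.proj T) := fun T hT => by
    rw [Commute, SemiconjBy, ← E.proj_inter _ _ hS hT, ← E.proj_inter _ _ hT hS, Set.inter_comm]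
  have := hE.graph_commute ha hc (a.mem_graph ξ)
  rw [ProjectionValuedMeasure.mem_subspace] at hξ ⊢
  rw [hξ] at this
  exact a.mem_graph_snd_inj this (a.mem_graph ξ) rfl

theorem norm_apply_le (ha : IsSelfAdjoint a) {r : ℝ} {ξ : a.domain}
    (hξ : (ξ : H) ∈ E.subspace (Set.Icc (-r) r)) : ‖a ξ‖ ≤ r * ‖(ξ : H)‖ := by
  rcases eq_or_ne (a ξ) 0 with h0 | h0
  · rw [h0, norm_zero]
    have := (abs_nonneg _).trans (E.abs_integral_le hξ)
    rcases eq_or_ne (ξ : H) 0 with h1 | h1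
    · simp [h1]
    · have := norm_pos_iff.2 h1
      nlinarith
  have hp : 0 < ‖a ξ‖ := norm_pos_iff.2 h0
  have hm := hE.apply_mem_subspace ha measurableSet_Icc hξ
  set s : ℝ := ‖(ξ : H)‖ / ‖a ξ‖ with hs
  have hηm : (s : ℂ) • a ξ ∈ E.subspace (Set.Icc (-r) r) := Submodule.smul_mem _ _ hm
  have h1 := hE.re_inner_eq ha ξ ⟨(s : ℂ) • a ξ, hE.subspace_le_domain r hηm⟩
  have h2 := abs_le.1 (E.abs_integral_le (Submodule.add_mem _ hξ hηm))
  have h3 := abs_le.1 (E.abs_integral_le (Submodule.sub_mem _ hξ hηm))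
  have h4 := parallelogram_law_with_norm ℂ (ξ : H) ((s : ℂ) • a ξ)
  have h5 : ‖(s : ℂ) • a ξ‖ = ‖(ξ : H)‖ := by
    rw [norm_smul, Complex.norm_real, Real.norm_of_nonneg (by positivity), hs]
    field_simp
  have h6 : (⟪(s : ℂ) • a ξ, a ξ⟫_ℂ).re = ‖(ξ : H)‖ * ‖a ξ‖ := by
    have h : ‖(ξ : H)‖ = s * ‖a ξ‖ := by rw [hs]; field_simp
    have h' : (⟪a ξ, a ξ⟫_ℂ).re = ‖a ξ‖ ^ 2 := inner_self_eq_norm_sq (𝕜 := ℂ) (a ξ)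
    rw [inner_smul_left, Complex.conj_ofReal, Complex.re_ofReal_mul, h', h]
    ring
  simp only at h1
  rw [h6] at h1
  rw [h5] at h4
  rcases eq_or_ne (ξ : H) 0 with h7 | h7
  · exact absurd (by rw [show ξ = 0 from Subtype.ext h7, LinearPMap.map_zero]) h0
  refine le_of_mul_le_mul_left ?_ (norm_pos_iff.2 h7)
  have h8 : r * ‖(ξ : H) + (s : ℂ) • a ξ‖ ^ 2 + r * ‖(ξ : H) - (s : ℂ) • a ξ‖ ^ 2
      = 4 * (‖(ξ : H)‖ * (r * ‖(ξ : H)‖)) := by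
    rw [← mul_add, h4]; ring
  linarith [h2.2, h3.1]

end IsSpectralMeasure

end

noncomputable section

variable {H : Type*} [NormedAddCommGroup H] [InnerProductSpace ℂ H] [CompleteSpace H]

section State

variable {M : VonNeumannAlgebra H} {τ : M.toStarSubalgebra →ₗ[ℂ] ℂ}
  (hτ : IsFaithfulNormalTracialState τ)

theorem mem_centralizer_commutant {a : H →L[ℂ] H} :
    a ∈ StarSubalgebra.centralizer ℂ (M.commutant : Set (H →L[ℂ] H)) ↔
      a ∈ M.toStarSubalgebra := by
  have h1 : a ∈ M.toStarSubalgebra ↔ a ∈ M.commutant.commutant := by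
    rw [M.commutant_commutant]; rfl
  rw [h1, VonNeumannAlgebra.mem_commutant_iff, StarSubalgebra.mem_centralizer_iff]
  exact ⟨fun h g hg => (h g hg).1,
    fun h g hg => ⟨h g hg, h _ (M.commutant.toStarSubalgebra.star_mem' hg)⟩⟩

open scoped Classical in
/-- The real part of `τ`, extended by zero. -/
def stateRe (τ : M.toStarSubalgebra →ₗ[ℂ] ℂ) (a : H →L[ℂ] H) : ℝ :=
  if h : a ∈ M.toStarSubalgebra then (τ ⟨a, h⟩).re else 0

theorem stateRe_of_mem {a : H →L[ℂ] H} (h : a ∈ M.toStarSubalgebra) :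
    stateRe τ a = (τ ⟨a, h⟩).re := dif_pos h

include hτ

/-- The semi-inner product `τ (a* b)`. -/
abbrev stateCore : PreInnerProductSpace.Core ℂ M.toStarSubalgebra where
  inner a b := τ (star a * b)
  conj_inner_symm a b := by
    have key : ∀ c : ℂ, (c * τ (star a * b) + star c * τ (star b * a)).im = 0 := fun c => by
      have h1 := (Complex.le_def.1 (hτ.nonneg (a + c • b))).2
      have h2 := (Complex.le_def.1 (hτ.nonneg a)).2
      have h3 := (Complex.le_def.1 (hτ.nonneg (c • b))).2
      simp only [star_add, star_smul, add_mul, mul_add, _root_.map_add, smul_mul_assoc,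
        mul_smul_comm, map_smul, smul_eq_mul, Complex.add_im, Complex.zero_im] at h1 h2 h3 ⊢
      linarith
    have h1 := key 1
    have h2 := key Complex.I
    simp at h1 h2
    apply Complex.ext <;> simp <;> linarith
  re_inner_nonneg a := (Complex.le_def.1 (hτ.nonneg a)).1
  add_left a b c := by rw [star_add, add_mul, _root_.map_add]
  smul_left a b c := by rw [star_smul, smul_mul_assoc, map_smul]; rfl

theorem norm_state_sq_le (a b : M.toStarSubalgebra) :
    ‖τ (star a * b)‖ ^ 2 ≤ (τ (star a * a)).re * (τ (star b * b)).re := by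
  let := stateCore hτ
  have h := InnerProductSpace.Core.inner_mul_inner_self_le (𝕜 := ℂ) a b
  have h2 := (stateCore hτ).conj_inner_symm a b
  have h3 : ‖τ (star b * a)‖ = ‖τ (star a * b)‖ := by
    have := congrArg norm h2
    rwa [RCLike.norm_conj] at this
  change ‖τ (star a * b)‖ * ‖τ (star b * a)‖ ≤ (τ (star a * a)).re * (τ (star b * b)).re at h
  rwa [h3, ← sq] at h

theorem state_re_nonneg {a : M.toStarSubalgebra} (ha : 0 ≤ (a : H →L[ℂ] H)) : 0 ≤ (τ a).re := by
  have hm : cfc Real.sqrt (a : H →L[ℂ] H) ∈ M.toStarSubalgebra := by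
    rw [← mem_centralizer_commutant, StarSubalgebra.mem_centralizer_iff]
    have := StarSubalgebra.mem_centralizer_iff (R := ℂ) |>.1
      (mem_centralizer_commutant (M := M).2 a.2)
    exact fun g hg => ⟨(Commute.cfc_real (show Commute (a : H →L[ℂ] H) g from (this g hg).1.symm)
      _).symm.eq, (Commute.cfc_real (show Commute (a : H →L[ℂ] H) (star g) from
        (this g hg).2.symm) _).symm.eq⟩
  have hs : IsSelfAdjoint (a : H →L[ℂ] H) := .of_nonneg ha
  have h1 : star (⟨_, hm⟩ : M.toStarSubalgebra) * ⟨_, hm⟩ = a := by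
    apply Subtype.ext
    change star (cfc Real.sqrt (a : H →L[ℂ] H)) * cfc Real.sqrt (a : H →L[ℂ] H) = a
    rw [(cfc_predicate Real.sqrt (a : H →L[ℂ] H) : IsSelfAdjoint _).star_eq,
      ← cfc_mul Real.sqrt Real.sqrt (a : H →L[ℂ] H)]
    conv_rhs => rw [← cfc_id' ℝ (a : H →L[ℂ] H)]
    exact cfc_congr fun x hx => Real.mul_self_sqrt (spectrum_nonneg_of_nonneg ha hx)
  rw [← h1]
  exact (Complex.le_def.1 (hτ.nonneg _)).1

theorem state_tendsto (a : ℕ → M.toStarSubalgebra) (b : M.toStarSubalgebra)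
    (ha : ∀ n, IsSelfAdjoint (a n : H →L[ℂ] H))
    (hm : Monotone fun n => (a n : H →L[ℂ] H))
    (hlim : ∀ ξ, Tendsto (fun n => (a n : H →L[ℂ] H) ξ) atTop (𝓝 ((b : H →L[ℂ] H) ξ))) :
    Tendsto (fun n => (τ (a n)).re) atTop (𝓝 (τ b).re) := by
  have hmono : Monotone fun n => (τ (a n)).re := fun m n hmn => by
    have := state_re_nonneg hτ (a := a n - a m) (sub_nonneg.2 (hm hmn))
    rw [_root_.map_sub, Complex.sub_re] at this
    linarith
  have hb : IsSelfAdjoint (b : H →L[ℂ] H) := by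
    rw [ContinuousLinearMap.isSelfAdjoint_iff_isSymmetric]
    intro ξ η
    refine tendsto_nhds_unique ((hlim ξ).inner (tendsto_const_nhds (x := η))) ?_
    refine ((tendsto_const_nhds (x := ξ)).inner (hlim η)).congr fun n => ?_
    exact ((ContinuousLinearMap.isSelfAdjoint_iff_isSymmetric.1 (ha n)) ξ η).symm
  have hre : ∀ ξ, Tendsto (fun n => (⟪(a n : H →L[ℂ] H) ξ, ξ⟫_ℂ).re) atTop
      (𝓝 (⟪(b : H →L[ℂ] H) ξ, ξ⟫_ℂ).re) := fun ξ =>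
    (Complex.continuous_re.tendsto _).comp ((hlim ξ).inner tendsto_const_nhds)
  have hle : ∀ {x y : H →L[ℂ] H}, IsSelfAdjoint x → IsSelfAdjoint y →
      (x ≤ y ↔ ∀ ξ, (⟪x ξ, ξ⟫_ℂ).re ≤ (⟪y ξ, ξ⟫_ℂ).re) := fun {x y} hx hy => by
    rw [ContinuousLinearMap.le_def, ContinuousLinearMap.isPositive_def]
    have : IsSelfAdjoint (y - x) := hy.sub hx
    rw [← ContinuousLinearMap.isSelfAdjoint_iff_isSymmetric]
    simp only [this, true_and, ContinuousLinearMap.reApplyInnerSelf_apply, sub_apply,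
      inner_sub_left, _root_.map_sub, sub_nonneg]
    rfl
  have hlub : IsLUB ((fun x : M.toStarSubalgebra => (x : H →L[ℂ] H)) '' Set.range a)
      (b : H →L[ℂ] H) := by
    constructor
    · rintro _ ⟨_, ⟨n, rfl⟩, rfl⟩
      rw [hle (ha n) hb]
      intro ξ
      refine ge_of_tendsto (hre ξ) (eventually_atTop.2 ⟨n, fun m hnm => ?_⟩)
      exact (hle (ha n) (ha m)).1 (hm hnm) ξ
    · intro c hc
      have hcn : ∀ n, (a n : H →L[ℂ] H) ≤ c := fun n => hc ⟨_, ⟨n, rfl⟩, rfl⟩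
      have hcs : IsSelfAdjoint c := by
        have : IsSelfAdjoint (c - a 0) := .of_nonneg (sub_nonneg.2 (hcn 0))
        simpa using this.add (ha 0)
      rw [hle hb hcs]
      exact fun ξ => le_of_tendsto' (hre ξ) fun n => (hle (ha n) hcs).1 (hcn n) ξ
  have h := hτ.normal (Set.range a) b (Set.range_nonempty a)
    (by rintro _ ⟨n, rfl⟩; exact Subtype.ext (ha n)) (by
      rintro _ ⟨_, ⟨m, rfl⟩, rfl⟩ _ ⟨_, ⟨n, rfl⟩, rfl⟩
      exact ⟨_, ⟨_, ⟨max m n, rfl⟩, rfl⟩, hm (le_max_left _ _), hm (le_max_right _ _)⟩) hlub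
  rw [← Set.range_comp] at h
  exact tendsto_atTop_isLUB hmono h

/-- The trace on a von Neumann algebra with a faithful normal tracial state. -/
def TraceData.ofState : TraceData H where
  comm := M.commutant
  star_mem_comm y hy := M.commutant.toStarSubalgebra.star_mem' hy
  t := stateRe τ
  map_add a ha b hb := by
    rw [mem_centralizer_commutant] at ha hb
    rw [stateRe_of_mem ha, stateRe_of_mem hb, stateRe_of_mem (add_mem ha hb), ← Complex.add_re,
      ← _root_.map_add]
    rfl
  star_mul_self_nonneg a ha := by
    rw [mem_centralizer_commutant] at ha
    rw [stateRe_of_mem (mul_mem (star_mem ha) ha)]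
    exact (Complex.le_def.1 (hτ.nonneg ⟨a, ha⟩)).1
  faithful a ha h0 := by
    rw [mem_centralizer_commutant] at ha
    rw [stateRe_of_mem (mul_mem (star_mem ha) ha)] at h0
    exact congrArg Subtype.val (hτ.faithful ⟨a, ha⟩
      (Complex.ext h0 (Complex.le_def.1 (hτ.nonneg ⟨a, ha⟩)).2.symm))
  map_mul_comm a ha b hb := by
    rw [mem_centralizer_commutant] at ha hb
    rw [stateRe_of_mem (mul_mem ha hb), stateRe_of_mem (mul_mem hb ha)]
    exact congrArg Complex.re (hτ.trace ⟨a, ha⟩ ⟨b, hb⟩)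
  normal a b ha hsa hm hlim := by
    have hb : b ∈ M.toStarSubalgebra := by
      rw [← mem_centralizer_commutant, StarSubalgebra.mem_centralizer_iff]
      have key : ∀ g : H →L[ℂ] H, (∀ n, g * a n = a n * g) → g * b = b * g := fun g hg => by
        ext ξ
        refine tendsto_nhds_unique ((g.continuous.tendsto _).comp (hlim ξ)) ?_
        exact (hlim (g ξ)).congr fun n => (congrArg (· ξ) (hg n)).symm
      refine fun g hg => ⟨key g fun n => ?_, key _ fun n => ?_⟩
      · exact ((StarSubalgebra.mem_centralizer_iff (R := ℂ)).1 (ha n) g hg).1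
      · exact ((StarSubalgebra.mem_centralizer_iff (R := ℂ)).1 (ha n) g hg).2
    simp only [mem_centralizer_commutant] at ha
    have := state_tendsto hτ (fun n => ⟨a n, ha n⟩) ⟨b, hb⟩ hsa hm hlim
    rw [stateRe_of_mem hb]
    exact this.congr fun n => (stateRe_of_mem (ha n)).symm

theorem mem_alg_ofState {a : H →L[ℂ] H} :
    a ∈ (TraceData.ofState hτ).alg ↔ a ∈ M.toStarSubalgebra := mem_centralizer_commutant

theorem ofState_t {a : H →L[ℂ] H} (h : a ∈ M.toStarSubalgebra) :
    (TraceData.ofState hτ).t a = (τ ⟨a, h⟩).re := stateRe_of_mem h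

theorem norm_state_mul_le (a b : M.toStarSubalgebra) :
    ‖τ (a * b)‖ ≤ ‖(a : H →L[ℂ] H)‖ * √(τ (star b * b)).re := by
  have h1 := norm_state_sq_le hτ (star a) b
  rw [star_star] at h1
  have h2 : (τ (a * star a)).re ≤ ‖(a : H →L[ℂ] H)‖ ^ 2 := by
    have h3 := state_re_nonneg hτ (a := ((‖(a : H →L[ℂ] H)‖ ^ 2 : ℝ) : ℂ) • 1 - a * star a)
      (sub_nonneg.2 (by
        have := CStarAlgebra.mul_star_le_algebraMap_norm_sq (a := (a : H →L[ℂ] H))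
        rwa [Algebra.algebraMap_eq_smul_one, ← Complex.coe_smul] at this))
    rw [_root_.map_sub, Complex.sub_re, map_smul, hτ.map_one] at h3
    simp only [smul_eq_mul, mul_one, Complex.ofReal_re] at h3
    linarith
  have h4 : 0 ≤ (τ (star b * b)).re := (Complex.le_def.1 (hτ.nonneg b)).1
  refine abs_le_of_sq_le_sq' ?_ (by positivity) |>.2
  rw [mul_pow, Real.sq_sqrt h4]
  exact h1.trans (mul_le_mul_of_nonneg_right h2 h4)

theorem norm_state_le (a : M.toStarSubalgebra) : ‖τ a‖ ≤ ‖(a : H →L[ℂ] H)‖ := by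
  have := norm_state_mul_le hτ a 1
  simpa [hτ.map_one] using this

end State

end

noncomputable section

/-- The Hilbert space `ℂᵈ ⊗ H`. -/
abbrev Amplification (d : ℕ) (H : Type*) : Type _ := PiLp 2 (fun _ : Fin d => H)

namespace Amplification

variable {H : Type*} [NormedAddCommGroup H] [InnerProductSpace ℂ H] {d : ℕ}

/-- The inclusion of a summand. -/
def incl (l : Fin d) : H →L[ℂ] Amplification d H :=
  LinearMap.mkContinuous
    { toFun := fun x => PiLp.single 2 l x
      map_add' := fun x y => PiLp.single_add 2 l
      map_smul' := fun c x => by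
        ext j
        rcases eq_or_ne j l with rfl | h
        · simp [PiLp.single_eq_same]
        · simp [h] } 1
    (fun x => by simp)

/-- The projection to a summand. -/
def coord (l : Fin d) : Amplification d H →L[ℂ] H := PiLp.proj 2 (fun _ : Fin d => H) l

theorem coord_apply (l : Fin d) (ξ : Amplification d H) : coord l ξ = ξ l := rfl

theorem incl_apply (l j : Fin d) (x : H) : incl l x j = if j = l then x else 0 := by
  change PiLp.single (β := fun _ : Fin d => H) 2 l x j = _
  split_ifs with h
  · subst h; exact PiLp.single_eq_same 2 _ _
  · exact PiLp.single_eq_of_ne 2 h _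

theorem sum_incl (ξ : Amplification d H) : ∑ l, incl l (ξ l) = ξ := by
  ext j
  rw [← coord_apply, _root_.map_sum]
  simp [coord_apply, incl_apply]

theorem norm_incl_le (l : Fin d) : ‖(incl l : H →L[ℂ] Amplification d H)‖ ≤ 1 :=
  LinearMap.mkContinuous_norm_le _ zero_le_one _

theorem norm_coord_le (l : Fin d) : ‖(coord l : Amplification d H →L[ℂ] H)‖ ≤ 1 :=
  ContinuousLinearMap.opNorm_le_bound _ zero_le_one fun ξ => by
    rw [one_mul]; exact PiLp.norm_apply_le ξ l

theorem norm_le_sum {d : ℕ} (ξ : Amplification d H) : ‖ξ‖ ≤ ∑ j, ‖ξ j‖ := by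
  have h1 : ‖ξ‖ = ‖∑ j, incl j (ξ j)‖ := congrArg norm (sum_incl ξ).symm
  have h2 : ∀ j : Fin d, ‖incl j (ξ j)‖ ≤ ‖ξ j‖ := fun j => by
    have h3 := (incl j : H →L[ℂ] Amplification d H).le_opNorm (ξ j)
    have h4 := norm_incl_le (H := H) j
    exact h3.trans (mul_le_of_le_one_left (norm_nonneg _) h4)
  rw [h1]
  exact (norm_sum_le Finset.univ fun j => incl j (ξ j)).trans (Finset.sum_le_sum fun j _ => h2 j)

theorem inner_incl (l : Fin d) (x : H) (ξ : Amplification d H) :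
    ⟪incl l x, ξ⟫_ℂ = ⟪x, ξ l⟫_ℂ := by
  rw [PiLp.inner_apply, Finset.sum_eq_single l]
  · simp [incl_apply]
  · intro j _ hj
    simp [incl_apply, hj]
  · simp

/-- The matrix entry of an operator. -/
def entry (Q : Amplification d H →L[ℂ] Amplification d H) (j l : Fin d) : H →L[ℂ] H :=
  coord j ∘L Q ∘L incl l

/-- The operator with the given matrix entries. -/
def ofEntries (m : Fin d → Fin d → H →L[ℂ] H) : Amplification d H →L[ℂ] Amplification d H :=
  ∑ j, ∑ l, incl j ∘L m j l ∘L coord l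

variable (P Q : Amplification d H →L[ℂ] Amplification d H)

theorem entry_apply (j l : Fin d) (x : H) : entry Q j l x = Q (incl l x) j := rfl

theorem apply_eq_sum (ξ : Amplification d H) (j : Fin d) : Q ξ j = ∑ l, entry Q j l (ξ l) := by
  conv_lhs => rw [← sum_incl ξ, _root_.map_sum, ← coord_apply, _root_.map_sum]
  rfl

theorem entry_mul (j l : Fin d) : entry (P * Q) j l = ∑ m, entry P j m * entry Q m l := by
  ext x
  rw [entry_apply, mul_apply_eq_comp, apply_eq_sum]
  simp [entry_apply]

theorem entry_add (j l : Fin d) : entry (P + Q) j l = entry P j l + entry Q j l := by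
  ext x; simp [entry_apply]

theorem entry_sub (j l : Fin d) : entry (P - Q) j l = entry P j l - entry Q j l := by
  ext x; simp [entry_apply]

theorem norm_entry_le (j l : Fin d) : ‖entry Q j l‖ ≤ ‖Q‖ := by
  calc _ ≤ ‖(coord j : Amplification d H →L[ℂ] H)‖ *
          (‖Q‖ * ‖(incl l : H →L[ℂ] Amplification d H)‖) :=
        (ContinuousLinearMap.opNorm_comp_le _ _).trans
          (mul_le_mul_of_nonneg_left (ContinuousLinearMap.opNorm_comp_le _ _) (norm_nonneg _))
    _ ≤ 1 * (‖Q‖ * 1) := by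
        gcongr
        · exact norm_coord_le j
        · exact norm_incl_le l
    _ = _ := by ring

variable {P Q}

theorem ext_entry (h : ∀ j l, entry P j l = entry Q j l) : P = Q := by
  ext ξ j
  rw [apply_eq_sum, apply_eq_sum]
  simp [h]

theorem ofEntries_apply (m : Fin d → Fin d → H →L[ℂ] H) (ξ : Amplification d H) (j : Fin d) :
    ofEntries m ξ j = ∑ l, m j l (ξ l) := by
  rw [← coord_apply, ofEntries]
  simp [coord_apply, incl_apply, Finset.sum_ite_irrel]

/-- The operator `1 ⊗ y`. -/
def diag (d : ℕ) (y : H →L[ℂ] H) : Amplification d H →L[ℂ] Amplification d H :=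
  ofEntries fun j l => if j = l then y else 0

theorem diag_apply (y : H →L[ℂ] H) (ξ : Amplification d H) (j : Fin d) :
    diag d y ξ j = y (ξ j) := by
  rw [diag, ofEntries_apply, Finset.sum_eq_single j]
  · simp
  · intro l _ hl
    simp [hl.symm]
  · simp

theorem diag_incl (y : H →L[ℂ] H) (l : Fin d) (x : H) : diag d y (incl l x) = incl l (y x) := by
  ext j
  rw [diag_apply, incl_apply, incl_apply]
  split_ifs <;> simp

theorem entry_diag (y : H →L[ℂ] H) (j l : Fin d) :
    entry (diag d y) j l = if j = l then y else 0 := by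
  ext x
  rw [entry_apply, diag_incl, incl_apply]
  split_ifs <;> simp

theorem commute_diag_iff {y : H →L[ℂ] H} :
    Commute (diag d y) Q ↔ ∀ j l, Commute y (entry Q j l) := by
  constructor
  · intro h j l
    ext x
    have := congrArg (fun T => T (incl l x) j) h.eq
    simpa [mul_apply_eq_comp, diag_apply, diag_incl, entry_apply] using this
  · intro h
    ext ξ j
    simp only [mul_apply_eq_comp, diag_apply]
    rw [apply_eq_sum, apply_eq_sum, _root_.map_sum]
    refine Finset.sum_congr rfl fun l _ => ?_
    rw [diag_apply]
    exact congrArg (· (ξ l)) (h j l).eq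

variable [CompleteSpace H]

theorem adjoint_incl (l : Fin d) : ContinuousLinearMap.adjoint (incl l : H →L[ℂ] _) = coord l := by
  symm
  rw [ContinuousLinearMap.eq_adjoint_iff]
  intro ξ x
  rw [← inner_conj_symm, ← inner_conj_symm ξ, inner_incl]
  rfl

theorem entry_star (j l : Fin d) : entry (star Q) j l = star (entry Q l j) := by
  rw [entry, entry, ContinuousLinearMap.star_eq_adjoint, ContinuousLinearMap.star_eq_adjoint,
    ContinuousLinearMap.adjoint_comp, ContinuousLinearMap.adjoint_comp, adjoint_incl,
    ← adjoint_incl l, ContinuousLinearMap.adjoint_adjoint]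
  rfl

theorem entry_nonneg (h : 0 ≤ Q) (l : Fin d) : 0 ≤ entry Q l l := by
  rw [ContinuousLinearMap.nonneg_iff_isPositive] at h ⊢
  have := h.adjoint_conj (incl l)
  rwa [adjoint_incl] at this

theorem diag_star (y : H →L[ℂ] H) : diag d (star y) = star (diag d y) := by
  apply ext_entry
  intro j l
  rw [entry_star, entry_diag, entry_diag]
  rcases eq_or_ne j l with rfl | h
  · simp
  · simp [h, h.symm]

end Amplification

namespace TraceData

open Amplification

variable {H : Type*} [NormedAddCommGroup H] [InnerProductSpace ℂ H] [CompleteSpace H]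
  (F : TraceData H) (d : ℕ)

theorem map_sum {ι : Type*} (s : Finset ι) (f : ι → H →L[ℂ] H) (hf : ∀ i ∈ s, f i ∈ F.alg) :
    F.t (∑ i ∈ s, f i) = ∑ i ∈ s, F.t (f i) := by
  classical
  induction s using Finset.induction_on with
  | empty => simp [F.map_zero]
  | insert a s ha ih =>
    rw [Finset.sum_insert ha, Finset.sum_insert ha, F.map_add _ (hf a (by simp)) _
      (sum_mem fun i hi => hf i (by simp [hi])), ih fun i hi => hf i (by simp [hi])]

/-- The commutant of the amplified algebra. -/
def ampComm : Set (Amplification d H →L[ℂ] Amplification d H) := diag d '' F.comm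

variable {d}

theorem mem_centralizer_ampComm {Q : Amplification d H →L[ℂ] Amplification d H} :
    Q ∈ StarSubalgebra.centralizer ℂ (F.ampComm d) ↔ ∀ j l, entry Q j l ∈ F.alg := by
  rw [StarSubalgebra.mem_centralizer_iff]
  simp only [mem_alg]
  constructor
  · intro h j l y hy
    exact commute_diag_iff.1 (h _ ⟨y, hy, rfl⟩).1 j l
  · rintro h _ ⟨y, hy, rfl⟩
    refine ⟨commute_diag_iff.2 fun j l => h j l y hy, ?_⟩
    rw [← diag_star]
    exact commute_diag_iff.2 fun j l => h j l _ (F.star_mem_comm y hy)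

variable (d)

/-- The trace on matrices over an algebra with a trace. -/
def amp : TraceData (Amplification d H) where
  comm := F.ampComm d
  star_mem_comm := by
    rintro _ ⟨y, hy, rfl⟩
    exact ⟨star y, F.star_mem_comm y hy, diag_star y⟩
  t Q := ∑ l, F.t (entry Q l l)
  map_add P hP Q hQ := by
    rw [mem_centralizer_ampComm] at hP hQ
    rw [← Finset.sum_add_distrib]
    exact Finset.sum_congr rfl fun l _ => by rw [entry_add, F.map_add _ (hP l l) _ (hQ l l)]
  star_mul_self_nonneg Q hQ := by
    rw [mem_centralizer_ampComm] at hQ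
    refine Finset.sum_nonneg fun l _ => ?_
    rw [entry_mul, F.map_sum _ _ fun m _ => ?_]
    · refine Finset.sum_nonneg fun m _ => ?_
      rw [entry_star]
      exact F.star_mul_self_nonneg _ (hQ m l)
    · rw [entry_star]
      exact mul_mem (star_mem (hQ m l)) (hQ m l)
  faithful Q hQ h0 := by
    rw [mem_centralizer_ampComm] at hQ
    have h1 : ∀ l, F.t (entry (star Q * Q) l l) = ∑ m, F.t (star (entry Q m l) * entry Q m l) :=
      fun l => by
        rw [entry_mul]
        simp only [entry_star]
        exact F.map_sum _ _ fun m _ => mul_mem (star_mem (hQ m l)) (hQ m l)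
    simp only [h1] at h0
    have h2 : ∀ l m, 0 ≤ F.t (star (entry Q m l) * entry Q m l) := fun l m =>
      F.star_mul_self_nonneg _ (hQ m l)
    apply ext_entry
    intro m l
    have h3 := (Finset.sum_eq_zero_iff_of_nonneg fun l _ => Finset.sum_nonneg fun m _ => h2 l m).1
      h0 l (Finset.mem_univ _)
    have h4 := (Finset.sum_eq_zero_iff_of_nonneg fun m _ => h2 l m).1 h3 m (Finset.mem_univ _)
    rw [F.faithful _ (hQ m l) h4]
    rfl
  map_mul_comm P hP Q hQ := by
    rw [mem_centralizer_ampComm] at hP hQ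
    have h : ∀ {P Q : Amplification d H →L[ℂ] Amplification d H},
        (∀ j l, entry P j l ∈ F.alg) → (∀ j l, entry Q j l ∈ F.alg) →
        ∑ l, F.t (entry (P * Q) l l) = ∑ l, ∑ m, F.t (entry P l m * entry Q m l) :=
      fun hP hQ => Finset.sum_congr rfl fun l _ => by
        rw [entry_mul]
        exact F.map_sum _ _ fun m _ => mul_mem (hP l m) (hQ m l)
    rw [h hP hQ, h hQ hP, Finset.sum_comm]
    exact Finset.sum_congr rfl fun l _ => Finset.sum_congr rfl fun m _ =>
      F.map_mul_comm _ (hP m l) _ (hQ l m)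
  normal a b ha hsa hm hlim := by
    refine tendsto_finsetSum _ fun l _ => F.normal _ _ (fun n => ?_) (fun n => ?_) ?_ ?_
    · exact (F.mem_centralizer_ampComm.1 (ha n)) l l
    · rw [IsSelfAdjoint, ← entry_star, (hsa n).star_eq]
    · intro m n hmn
      have := entry_nonneg (sub_nonneg.2 (hm hmn)) l
      rw [entry_sub] at this
      exact sub_nonneg.1 this
    · exact fun ξ => ((coord l).continuous.tendsto _).comp (hlim (incl l ξ))

variable {d}

theorem mem_alg_amp {Q : Amplification d H →L[ℂ] Amplification d H} :
    Q ∈ (F.amp d).alg ↔ ∀ j l, entry Q j l ∈ F.alg := F.mem_centralizer_ampComm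

theorem amp_t (Q : Amplification d H →L[ℂ] Amplification d H) :
    (F.amp d).t Q = ∑ l, F.t (entry Q l l) := rfl

end TraceData

namespace Amplification

variable {H : Type*} [NormedAddCommGroup H] [InnerProductSpace ℂ H]

/-- The subspace `ℂᵈ ⊗ V`. -/
def ampSub (d : ℕ) (V : Submodule ℂ H) : Submodule ℂ (Amplification d H) :=
  ⨅ l, V.comap (coord l).toLinearMap

theorem mem_ampSub {d : ℕ} {V : Submodule ℂ H} {ξ : Amplification d H} :
    ξ ∈ ampSub d V ↔ ∀ l, ξ l ∈ V := by
  simp [ampSub, Submodule.mem_iInf, coord_apply]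

theorem isClosed_ampSub (d : ℕ) {V : Submodule ℂ H} (hV : IsClosed (V : Set H)) :
    IsClosed (ampSub d V : Set (Amplification d H)) := by
  have : (ampSub d V : Set (Amplification d H)) = ⋂ l, coord l ⁻¹' (V : Set H) := by
    ext ξ; simp [mem_ampSub, coord_apply]
  rw [this]
  exact isClosed_iInter fun l => hV.preimage (coord l).continuous

variable [CompleteSpace H]

theorem hasOrthogonalProjection_orthogonal {K : Type*} [NormedAddCommGroup K]
    [InnerProductSpace ℂ K] [CompleteSpace K] (V : Submodule ℂ K) : Vᗮ.HasOrthogonalProjection :=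
  inferInstance

instance {d : ℕ} (V : Submodule ℂ (Amplification d H)) : Vᗮ.HasOrthogonalProjection :=
  hasOrthogonalProjection_orthogonal V

theorem starProjection_ampSub_orthogonal {d : ℕ} (V : Submodule ℂ H) :
    (ampSub d V)ᗮ.starProjection = diag d Vᗮ.starProjection := by
  ext ξ : 1
  apply Submodule.eq_starProjection_of_mem_orthogonal
  · rw [Submodule.mem_orthogonal]
    intro u hu
    rw [PiLp.inner_apply]
    refine Finset.sum_eq_zero fun l _ => ?_
    rw [diag_apply]
    exact (Submodule.mem_orthogonal _ _).1 (Submodule.starProjection_apply_mem Vᗮ (ξ l)) _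
      (mem_ampSub.1 hu l)
  · rw [Submodule.mem_orthogonal]
    intro u hu
    have h1 : ∀ l, u l ∈ Vᗮ := fun l => by
      rw [Submodule.mem_orthogonal]
      intro v hv
      rw [← inner_incl]
      refine (Submodule.mem_orthogonal _ _).1 hu _ (mem_ampSub.2 fun j => ?_)
      rw [incl_apply]
      split_ifs
      exacts [hv, V.zero_mem]
    rw [PiLp.inner_apply]
    refine Finset.sum_eq_zero fun l _ => ?_
    have h2 : (ξ - diag d Vᗮ.starProjection ξ) l = ξ l - Vᗮ.starProjection (ξ l) := by
      rw [PiLp.sub_apply, diag_apply]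
    rw [h2]
    exact (Submodule.mem_orthogonal _ _).1
      (Submodule.sub_starProjection_mem_orthogonal (K := Vᗮ) (ξ l)) _ (h1 l)

end Amplification

namespace TraceData

open Amplification

variable {H : Type*} [NormedAddCommGroup H] [InnerProductSpace ℂ H] [CompleteSpace H]
  {F : TraceData H} (d : ℕ)

theorem codim_ampSub (V : Submodule ℂ H) : (F.amp d).codim (ampSub d V) = d * F.codim V := by
  rw [codim, starProjection_ampSub_orthogonal, amp_t]
  simp [entry_diag, codim]

theorem Inv.ampSub {V : Submodule ℂ H} (hV : F.Inv V) : (F.amp d).Inv (ampSub d V) := by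
  rintro _ ⟨y, hy, rfl⟩ ξ hξ
  rw [mem_ampSub] at hξ ⊢
  intro l
  rw [diag_apply]
  exact hV y hy _ (hξ l)

end TraceData

end

noncomputable section

section Unbounded

variable {K : Type*} [NormedAddCommGroup K] [InnerProductSpace ℂ K] [CompleteSpace K]

theorem exists_bounded_restriction {T : K →ₗ.[ℂ] K} (hT : T.IsClosable) {V : Submodule ℂ K}
    [V.HasOrthogonalProjection] (hV : V ≤ T.domain) :
    ∃ Y : K →L[ℂ] K, ∀ ξ, (V.starProjection ξ, Y ξ) ∈ T.graph := by
  let g : K →ₗ[ℂ] K := T.toFun ∘ₗ Submodule.inclusion hV ∘ₗ V.orthogonalProjectionOnto.toLinearMap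
  have hg : ∀ ξ, (V.starProjection ξ, g ξ) ∈ T.graph := fun ξ =>
    T.mem_graph (Submodule.inclusion hV (V.orthogonalProjectionOnto ξ))
  have hcl : ∀ ξ, (V.starProjection ξ, g ξ) ∈ T.closure.graph := fun ξ =>
    LinearPMap.le_graph_of_le T.le_closure (hg ξ)
  have hc : Continuous g := by
    refine g.continuous_of_isClosed_graph (IsSeqClosed.isClosed fun u x hu hux => ?_)
    have h1 : Tendsto (fun n => (V.starProjection (u n).1, g (u n).1)) atTop
        (𝓝 (V.starProjection x.1, x.2)) := by
      have h2 := (continuous_fst.tendsto _).comp hux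
      have h3 := (continuous_snd.tendsto _).comp hux
      refine ((V.starProjection.continuous.tendsto _).comp h2).prodMk_nhds (h3.congr fun n => ?_)
      exact hu n
    have h4 := hT.closure_isClosed.mem_of_tendsto h1 (Eventually.of_forall fun n => hcl _)
    exact T.closure.mem_graph_snd_inj h4 (hcl x.1) rfl
  exact ⟨⟨g, hc⟩, hg⟩

theorem isClosable_of_isFormalAdjoint {T S : K →ₗ.[ℂ] K} (h : T.IsFormalAdjoint S)
    (hT : Dense (T.domain : Set K)) : S.IsClosable :=
  (LinearPMap.adjoint_isClosed hT).isClosable.leIsClosable (h.le_adjoint hT)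

theorem exists_bounded_inverse {G : Submodule ℂ (K × K)} (hG : IsClosed (G : Set (K × K)))
    {ε : ℝ} (hε : 0 < ε) (hb : ∀ ξ η, (ξ, η) ∈ G → ε * ‖ξ‖ ≤ ‖η‖)
    (hd : Dense {η : K | ∃ ξ, (ξ, η) ∈ G}) :
    ∃ R : K →L[ℂ] K, (∀ ξ η, (ξ, η) ∈ G ↔ ξ = R η) ∧ ‖R‖ ≤ ε⁻¹ := by
  have hsur : ∀ η, ∃ ξ, (ξ, η) ∈ G := by
    intro η
    obtain ⟨u, hu, hul⟩ := mem_closure_iff_seq_limit.1 (hd η)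
    choose v hv using hu
    have hcau : CauchySeq v := by
      rw [Metric.cauchySeq_iff]
      intro δ hδ
      obtain ⟨N, hN⟩ := Metric.cauchySeq_iff.1 hul.cauchySeq (ε * δ) (by positivity)
      refine ⟨N, fun m hm n hn => ?_⟩
      have h1 := hb _ _ (G.sub_mem (hv m) (hv n))
      have h2 := hN m hm n hn
      rw [dist_eq_norm] at h2 ⊢
      exact lt_of_mul_lt_mul_left (h1.trans_lt h2) hε.le
    obtain ⟨ξ, hξ⟩ := cauchySeq_tendsto_of_complete hcau
    exact ⟨ξ, hG.mem_of_tendsto (hξ.prodMk_nhds hul) (Eventually.of_forall hv)⟩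
  have huniq : ∀ {ξ ξ' η}, (ξ, η) ∈ G → (ξ', η) ∈ G → ξ = ξ' := by
    intro ξ ξ' η h h'
    have h1 := hb (ξ - ξ') 0 (by simpa using G.sub_mem h h')
    rw [norm_zero] at h1
    have : ‖ξ - ξ'‖ = 0 := le_antisymm (by nlinarith [norm_nonneg (ξ - ξ')]) (norm_nonneg _)
    exact sub_eq_zero.1 (norm_eq_zero.1 this)
  choose r hr using hsur
  have hle : ∀ η, ‖r η‖ ≤ ε⁻¹ * ‖η‖ := fun η => by
    rw [inv_mul_eq_div, le_div_iff₀ hε, mul_comm]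
    exact hb _ _ (hr η)
  let R : K →ₗ[ℂ] K :=
    { toFun := r
      map_add' := fun x y => huniq (hr _) (G.add_mem (hr x) (hr y))
      map_smul' := fun c x => huniq (hr _) (G.smul_mem c (hr x)) }
  refine ⟨R.mkContinuous ε⁻¹ hle, fun ξ η => ⟨fun h => huniq h (hr η), ?_⟩,
    LinearMap.mkContinuous_norm_le _ (by positivity) _⟩
  rintro rfl
  exact hr η

end Unbounded

namespace TraceData

variable {K : Type*} [NormedAddCommGroup K] [InnerProductSpace ℂ K] [CompleteSpace K]
  {F : TraceData K}

theorem exists_image {T : K →ₗ.[ℂ] K} (hT : T.IsClosable)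
    (hcomm : ∀ y ∈ F.comm, ∀ ξ η, (ξ, η) ∈ T.graph → (y ξ, y η) ∈ T.graph)
    (hinj : ∀ ξ, (ξ, 0) ∈ T.graph → ξ = 0) {V : Submodule ℂ K} (hVi : F.Inv V)
    (hVc : IsClosed (V : Set K)) (hV : V ≤ T.domain) :
    ∃ W : Submodule ℂ K, F.Inv W ∧ F.codim W ≤ F.codim V ∧
      ∀ η ∈ W, ∃ ξ ∈ V, (ξ, η) ∈ T.graph := by
  have : CompleteSpace V := hVc.completeSpace_coe
  obtain ⟨Y, hY⟩ := exists_bounded_restriction hT hV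
  have hYm : Y ∈ F.alg := by
    rw [mem_alg]
    intro y hy
    ext ξ
    have h1 := hcomm y hy _ _ (hY ξ)
    have h2 : y (V.starProjection ξ) = V.starProjection (y ξ) :=
      congrArg (· ξ) (F.mem_alg.1 hVi.starProjection_mem y hy).eq
    rw [h2] at h1
    exact T.mem_graph_snd_inj h1 (hY _) rfl
  refine ⟨LinearMap.range Y.toLinearMap, inv_range hYm, codim_map_le hVi hYm fun ξ hξ => ?_, ?_⟩
  · have h1 := hY ξ
    rw [show Y ξ = 0 from hξ] at h1
    exact (Submodule.starProjection_apply_eq_zero_iff _).1 (hinj _ h1)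
  · rintro _ ⟨ξ, rfl⟩
    exact ⟨_, Submodule.starProjection_apply_mem _ _, hY ξ⟩

theorem codim_top : F.codim ⊤ = 0 := by
  have : (⊤ : Submodule ℂ K)ᗮ.starProjection = 0 := by
    ext x
    refine (Submodule.starProjection_apply_eq_zero_iff _).2 ?_
    exact Submodule.le_orthogonal_orthogonal _ trivial
  rw [codim, this, F.map_zero]

theorem codim_biInf_le {ι : Type*} (s : Finset ι) (V : ι → Submodule ℂ K)
    (hV : ∀ i ∈ s, F.Inv (V i)) (hc : ∀ i ∈ s, IsClosed (V i : Set K)) :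
    F.Inv (⨅ i ∈ s, V i) ∧ IsClosed ((⨅ i ∈ s, V i : Submodule ℂ K) : Set K) ∧
      F.codim (⨅ i ∈ s, V i) ≤ ∑ i ∈ s, F.codim (V i) := by
  classical
  induction s using Finset.induction_on with
  | empty =>
    simp only [Finset.notMem_empty, iInf_false, iInf_top, Finset.sum_empty, codim_top, le_refl,
      and_true]
    exact ⟨fun _ _ _ _ => trivial, isClosed_univ⟩
  | insert a s ha ih =>
    obtain ⟨h1, h2, h3⟩ := ih (fun i hi => hV i (by simp [hi])) fun i hi => hc i (by simp [hi])
    rw [Finset.iInf_insert, Finset.sum_insert ha]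
    have h4 := hV a (by simp)
    have h5 := hc a (by simp)
    exact ⟨h4.inf h1, h5.inter h2, (codim_inf_le h4 h1 h5 h2).trans (by gcongr)⟩

theorem dense_of_codim_le {D : Submodule ℂ K} (hD : F.Inv D)
    (h : ∀ δ > 0, ∃ V : Submodule ℂ K, F.Inv V ∧ V ≤ D ∧ F.codim V ≤ δ) :
    Dense (D : Set K) := by
  refine dense_of_codim_eq_zero hD (le_antisymm (le_of_forall_pos_le_add fun δ hδ => ?_)
    (codim_nonneg hD))
  obtain ⟨V, hV, hVD, hle⟩ := h δ hδ
  rw [zero_add]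
  exact (codim_anti hV hD hVD).trans hle

variable (F) in
/-- A self-adjoint operator whose spectral projections lie in the algebra. -/
def Affiliated (a : K →ₗ.[ℂ] K) : Prop :=
  IsSelfAdjoint a ∧ ∃ E : ProjectionValuedMeasure K, IsSpectralMeasure a E ∧
    ∀ S, MeasurableSet S → E.proj S ∈ F.alg

theorem inv_subspace {E : ProjectionValuedMeasure K} {S : Set ℝ} (h : E.proj S ∈ F.alg) :
    F.Inv (E.subspace S) :=
  inv_ker (sub_mem (one_mem _) h)

theorem codim_subspace {E : ProjectionValuedMeasure K} {S : Set ℝ} (hS : MeasurableSet S) :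
    F.codim (E.subspace S) = F.t (E.proj Sᶜ) := by
  rw [codim, E.starProjection_orthogonal_subspace hS]

namespace Affiliated

variable {a : K →ₗ.[ℂ] K}

theorem graph_commute (ha : F.Affiliated a) {y : K →L[ℂ] K} (hy : y ∈ F.comm) {ξ η : K}
    (h : (ξ, η) ∈ a.graph) : (y ξ, y η) ∈ a.graph := by
  obtain ⟨hs, E, hE, hm⟩ := ha
  exact hE.graph_commute hs (fun S hS => F.mem_alg.1 (hm S hS) y hy) h

theorem inv_domain (ha : F.Affiliated a) : F.Inv a.domain := by
  intro y hy ξ hξ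
  obtain ⟨η, hη⟩ := LinearPMap.mem_domain_iff.1 hξ
  exact LinearPMap.mem_domain_iff.2 ⟨_, ha.graph_commute hy hη⟩

theorem exists_subspace (ha : F.Affiliated a) {δ : ℝ} (hδ : 0 < δ) :
    ∃ V : Submodule ℂ K, F.Inv V ∧ IsClosed (V : Set K) ∧ V ≤ a.domain ∧ F.codim V ≤ δ := by
  obtain ⟨hs, E, hE, hm⟩ := ha
  have h := codim_tendsto_zero (F := F)
    (fun n : ℕ => inv_subspace (hm (Set.Icc (-(n : ℝ)) n) measurableSet_Icc))
    (fun m n hmn => E.subspace_mono measurableSet_Icc measurableSet_Icc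
      (Set.Icc_subset_Icc (neg_le_neg (Nat.cast_le.2 hmn)) (Nat.cast_le.2 hmn)))
    E.dense_iUnion_subspace
  obtain ⟨n, hn⟩ := (h.eventually (gt_mem_nhds hδ)).exists
  exact ⟨_, inv_subspace (hm _ measurableSet_Icc), E.isClosed_subspace _,
    hE.subspace_le_domain n, hn.le⟩

theorem exists_common_subspace {ι : Type*} [Fintype ι] {a : ι → K →ₗ.[ℂ] K}
    (ha : ∀ i, F.Affiliated (a i)) {δ : ℝ} (hδ : 0 < δ) :
    ∃ V : Submodule ℂ K, F.Inv V ∧ IsClosed (V : Set K) ∧ (∀ i, V ≤ (a i).domain) ∧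
      F.codim V ≤ Fintype.card ι * δ := by
  choose V hV hVc hVd hVδ using fun i => (ha i).exists_subspace hδ
  obtain ⟨h1, h2, h3⟩ := codim_biInf_le Finset.univ V (fun i _ => hV i) fun i _ => hVc i
  refine ⟨_, h1, h2, fun i => (iInf₂_le i (Finset.mem_univ i)).trans (hVd i), h3.trans ?_⟩
  refine (Finset.sum_le_sum fun i _ => hVδ i).trans_eq ?_
  simp

end Affiliated

end TraceData

end

noncomputable section

section Graph

variable {H : Type*} [NormedAddCommGroup H] [InnerProductSpace ℂ H]

theorem mem_graph_add {f g : H →ₗ.[ℂ] H} {ξ η : H} :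
    (ξ, η) ∈ (f + g).graph ↔ ∃ η₁ η₂, (ξ, η₁) ∈ f.graph ∧ (ξ, η₂) ∈ g.graph ∧ η = η₁ + η₂ := by
  constructor
  · intro h
    obtain ⟨x, rfl, rfl⟩ := (LinearPMap.mem_graph_iff _).1 h
    exact ⟨_, _, f.mem_graph ⟨x, x.2.1⟩, g.mem_graph ⟨x, x.2.2⟩, LinearPMap.add_apply f g x⟩
  · rintro ⟨_, _, h1, h2, rfl⟩
    obtain ⟨x, rfl, rfl⟩ := (LinearPMap.mem_graph_iff _).1 h1
    obtain ⟨y, hy, rfl⟩ := (LinearPMap.mem_graph_iff _).1 h2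
    have hy : (y : H) = x := hy
    have hx : (x : H) ∈ g.domain := hy ▸ y.2
    rw [show y = ⟨x, hx⟩ from Subtype.ext hy]
    exact (f + g).mem_graph ⟨x, x.2, hx⟩

theorem mem_graph_sub {f g : H →ₗ.[ℂ] H} {ξ η : H} :
    (ξ, η) ∈ (f - g).graph ↔ ∃ η₁ η₂, (ξ, η₁) ∈ f.graph ∧ (ξ, η₂) ∈ g.graph ∧ η = η₁ - η₂ := by
  constructor
  · intro h
    obtain ⟨x, rfl, rfl⟩ := (LinearPMap.mem_graph_iff _).1 h
    exact ⟨_, _, f.mem_graph ⟨x, x.2.1⟩, g.mem_graph ⟨x, x.2.2⟩, LinearPMap.sub_apply f g x⟩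
  · rintro ⟨_, _, h1, h2, rfl⟩
    obtain ⟨x, rfl, rfl⟩ := (LinearPMap.mem_graph_iff _).1 h1
    obtain ⟨y, hy, rfl⟩ := (LinearPMap.mem_graph_iff _).1 h2
    have hy : (y : H) = x := hy
    have hx : (x : H) ∈ g.domain := hy ▸ y.2
    rw [show y = ⟨x, hx⟩ from Subtype.ext hy]
    exact (f - g).mem_graph ⟨x, x.2, hx⟩

theorem mem_graph_sum {ι : Type*} (s : Finset ι) (f : ι → H →ₗ.[ℂ] H) {ξ η : H} :
    (ξ, η) ∈ (∑ i ∈ s, f i).graph ↔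
      ∃ ζ : ι → H, (∀ i ∈ s, (ξ, ζ i) ∈ (f i).graph) ∧ η = ∑ i ∈ s, ζ i := by
  classical
  induction s using Finset.induction_on generalizing η with
  | empty =>
    simp only [Finset.sum_empty, Finset.notMem_empty, false_imp_iff, implies_true, true_and,
      exists_const]
    rw [LinearPMap.mem_graph_iff]
    exact ⟨fun ⟨y, _, h⟩ => h.symm, fun h => ⟨⟨ξ, trivial⟩, rfl, h.symm⟩⟩
  | insert a s ha ih =>
    rw [Finset.sum_insert ha, mem_graph_add]
    simp only [ih, Finset.sum_insert ha]
    constructor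
    · rintro ⟨η₁, _, h1, ⟨ζ, hζ, rfl⟩, rfl⟩
      have hne : ∀ i ∈ s, i ≠ a := fun i hi h => ha (h ▸ hi)
      refine ⟨Function.update ζ a η₁, fun i hi => ?_, ?_⟩
      · rcases Finset.mem_insert.1 hi with rfl | hi
        · simpa using h1
        · simpa [hne i hi] using hζ i hi
      · rw [Function.update_self]
        congr 1
        exact Finset.sum_congr rfl fun i hi => by rw [Function.update_of_ne (hne i hi)]
    · rintro ⟨ζ, hζ, rfl⟩
      exact ⟨_, _, hζ a (by simp), ⟨ζ, fun i hi => hζ i (by simp [hi]), rfl⟩, rfl⟩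

theorem inner_graph_symm [CompleteSpace H] {a : H →ₗ.[ℂ] H} (ha : IsSelfAdjoint a) {u v u' v' : H}
    (h : (u, v) ∈ a.graph) (h' : (u', v') ∈ a.graph) : ⟪v, u'⟫_ℂ = ⟪u, v'⟫_ℂ := by
  obtain ⟨x, rfl, rfl⟩ := (LinearPMap.mem_graph_iff _).1 h
  obtain ⟨y, rfl, rfl⟩ := (LinearPMap.mem_graph_iff _).1 h'
  exact isFormalAdjoint_self ha x y

theorem norm_le_of_mem_topologicalClosure {G : Submodule ℂ (H × H)} {ε : ℝ}
    (hb : ∀ ξ η, (ξ, η) ∈ G → ε * ‖ξ‖ ≤ ‖η‖) {ξ η : H} (h : (ξ, η) ∈ G.topologicalClosure) :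
    ε * ‖ξ‖ ≤ ‖η‖ := by
  have hc : IsClosed {p : H × H | ε * ‖p.1‖ ≤ ‖p.2‖} :=
    isClosed_le (by fun_prop) (by fun_prop)
  exact closure_minimal (fun p hp => hb p.1 p.2 hp) hc h

theorem map_mem_topologicalClosure {G : Submodule ℂ (H × H)} {Y : H →L[ℂ] H}
    (hY : ∀ ξ η, (ξ, η) ∈ G → (Y ξ, Y η) ∈ G) {ξ η : H} (h : (ξ, η) ∈ G.topologicalClosure) :
    (Y ξ, Y η) ∈ G.topologicalClosure :=
  map_mem_closure (f := fun p : H × H => (Y p.1, Y p.2)) (by fun_prop) h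
    fun p hp => hY p.1 p.2 hp

end Graph

section Pencil

open Amplification

variable {H : Type*} [NormedAddCommGroup H] [InnerProductSpace ℂ H] {d k : ℕ}

theorem mem_graph_matrixTensor {A : Matrix (Fin d) (Fin d) ℂ} {x : H →ₗ.[ℂ] H}
    {ξ η : Amplification d H} :
    (ξ, η) ∈ (matrixTensor A x).graph ↔
      ∃ ζ : Fin d → H, (∀ l, (ξ l, ζ l) ∈ x.graph) ∧ ∀ j, η j = ∑ l, A j l • ζ l := by
  constructor
  · intro h
    obtain ⟨u, rfl, rfl⟩ := (LinearPMap.mem_graph_iff _).1 h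
    exact ⟨fun l => x ⟨(u : Amplification d H) l, u.2 l⟩, fun l => x.mem_graph ⟨_, u.2 l⟩,
      fun j => rfl⟩
  · rintro ⟨ζ, hζ, hη⟩
    have hm : ∀ l, ξ l ∈ x.domain := fun l => LinearPMap.mem_domain_of_mem_graph (hζ l)
    have hval : ∀ l, x ⟨ξ l, hm l⟩ = ζ l := fun l =>
      x.mem_graph_snd_inj (x.mem_graph _) (hζ l) rfl
    rw [LinearPMap.mem_graph_iff]
    refine ⟨⟨ξ, hm⟩, rfl, ?_⟩
    ext j
    rw [hη]
    change ∑ l, A j l • x ⟨ξ l, hm l⟩ = _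
    simp only [hval]

/-- The operator `B ⊗ 1 - ∑ i, A i ⊗ x i` on the common domain of the terms. -/
def prePencil (B : Matrix (Fin d) (Fin d) ℂ) (A : Fin k → Matrix (Fin d) (Fin d) ℂ)
    (x : Fin k → H →ₗ.[ℂ] H) : Amplification d H →ₗ.[ℂ] Amplification d H :=
  matrixTensor B (idOp H) - ∑ i, matrixTensor (A i) (x i)

variable {B : Matrix (Fin d) (Fin d) ℂ} {A : Fin k → Matrix (Fin d) (Fin d) ℂ}
  {x : Fin k → H →ₗ.[ℂ] H}

theorem mem_graph_prePencil {ξ η : Amplification d H} :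
    (ξ, η) ∈ (prePencil B A x).graph ↔
      ∃ ζ : Fin k → Fin d → H, (∀ i l, (ξ l, ζ i l) ∈ (x i).graph) ∧
        ∀ j, η j = ∑ l, B j l • ξ l - ∑ i, ∑ l, A i j l • ζ i l := by
  have hid : ∀ {u v : H}, (u, v) ∈ (idOp H).graph ↔ v = u := fun {u v} => by
    rw [LinearPMap.mem_graph_iff]
    exact ⟨fun ⟨y, h, h'⟩ => h'.symm.trans h, fun h => ⟨⟨u, trivial⟩, rfl, h.symm⟩⟩
  rw [prePencil, mem_graph_sub]
  simp only [mem_graph_sum, mem_graph_matrixTensor, hid, Finset.mem_univ, forall_const]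
  constructor
  · rintro ⟨η₁, _, ⟨ζ₁, h1, h1'⟩, ⟨θ, hθ, rfl⟩, rfl⟩
    choose ζ hζ hζ' using hθ
    refine ⟨ζ, hζ, fun j => ?_⟩
    rw [PiLp.sub_apply, h1', ← coord_apply _ (∑ i, θ i), _root_.map_sum]
    simp only [h1, coord_apply, hζ']
  · rintro ⟨ζ, hζ, hη⟩
    refine ⟨WithLp.toLp 2 fun j => ∑ l, B j l • ξ l,
      ∑ i, WithLp.toLp 2 fun j => ∑ l, A i j l • ζ i l, ⟨fun l => ξ l, fun _ => rfl, fun _ => rfl⟩,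
      ⟨_, fun i => ⟨ζ i, hζ i, fun _ => rfl⟩, rfl⟩, ?_⟩
    ext j
    rw [hη, PiLp.sub_apply, ← coord_apply _ (∑ i, _), _root_.map_sum]
    rfl

theorem mem_domain_prePencil {ξ : Amplification d H} :
    ξ ∈ (prePencil B A x).domain ↔ ∀ i l, ξ l ∈ (x i).domain := by
  constructor
  · intro h i l
    obtain ⟨η, hη⟩ := LinearPMap.mem_domain_iff.1 h
    obtain ⟨ζ, hζ, _⟩ := mem_graph_prePencil.1 hη
    exact LinearPMap.mem_domain_of_mem_graph (hζ i l)
  · intro h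
    refine LinearPMap.mem_domain_iff.2 ⟨WithLp.toLp 2 fun j =>
      ∑ l, B j l • ξ l - ∑ i, ∑ l, A i j l • x i ⟨ξ l, h i l⟩, mem_graph_prePencil.2
      ⟨fun i l => x i ⟨ξ l, h i l⟩, fun i l => (x i).mem_graph ⟨_, h i l⟩, fun j => rfl⟩⟩

theorem prePencil_le_pencil : (prePencil B A x).graph ≤ (pencil B A x).graph :=
  LinearPMap.le_graph_of_le (LinearPMap.le_closure _)

theorem graph_prePencil_diag {y : H →L[ℂ] H}
    (hy : ∀ i u v, (u, v) ∈ (x i).graph → (y u, y v) ∈ (x i).graph) {ξ η : Amplification d H}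
    (h : (ξ, η) ∈ (prePencil B A x).graph) :
    (diag d y ξ, diag d y η) ∈ (prePencil B A x).graph := by
  obtain ⟨ζ, hζ, hη⟩ := mem_graph_prePencil.1 h
  refine mem_graph_prePencil.2 ⟨fun i l => y (ζ i l), fun i l => ?_, fun j => ?_⟩
  · rw [diag_apply]
    exact hy i _ _ (hζ i l)
  · simp only [diag_apply, hη, _root_.map_sub, _root_.map_sum, map_smul]

theorem norm_sub_le_of_mem_graph_prePencil {d k : ℕ} {B : Matrix (Fin d) (Fin d) ℂ}
    {A : Fin k → Matrix (Fin d) (Fin d) ℂ} {x y : Fin k → H →ₗ.[ℂ] H} {δ : ℝ}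
    {ξ η η' : Amplification d H}
    (h : ∀ i l v v', (ξ l, v) ∈ (y i).graph → (ξ l, v') ∈ (x i).graph → ‖v - v'‖ ≤ δ * ‖ξ l‖)
    (hδ : 0 ≤ δ) (hη : (ξ, η) ∈ (prePencil B A x).graph)
    (hη' : (ξ, η') ∈ (prePencil B A y).graph) :
    ‖η - η'‖ ≤ (∑ j, ∑ i, ∑ l, ‖A i j l‖) * (δ * ‖ξ‖) := by
  obtain ⟨ζ, hζ, h1⟩ := mem_graph_prePencil.1 hη
  obtain ⟨ζ', hζ', h2⟩ := mem_graph_prePencil.1 hη'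
  refine (norm_le_sum _).trans ?_
  rw [Finset.sum_mul]
  refine Finset.sum_le_sum fun j _ => ?_
  have h3 : (η - η') j = ∑ i, ∑ l, A i j l • (ζ' i l - ζ i l) := by
    rw [PiLp.sub_apply, h1, h2, sub_sub_sub_cancel_left]
    simp only [smul_sub, Finset.sum_sub_distrib]
  rw [h3, Finset.sum_mul]
  refine (norm_sum_le _ _).trans (Finset.sum_le_sum fun i _ => ?_)
  rw [Finset.sum_mul]
  refine (norm_sum_le _ _).trans (Finset.sum_le_sum fun l _ => ?_)
  rw [norm_smul]
  have h4 := h i l _ _ (hζ' i l) (hζ i l)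
  have h5 := PiLp.norm_apply_le ξ l
  gcongr
  exact h4.trans (by gcongr)

theorem norm_sub_apply_le {d k : ℕ} {B : Matrix (Fin d) (Fin d) ℂ}
    {A : Fin k → Matrix (Fin d) (Fin d) ℂ} {x y : Fin k → H →ₗ.[ℂ] H} {δ ε : ℝ} (hδ : 0 ≤ δ)
    (hε : 0 < ε) {R R' : Amplification d H →L[ℂ] Amplification d H} (hRn : ‖R‖ ≤ ε⁻¹)
    (hRn' : ‖R'‖ ≤ ε⁻¹) (hR : ∀ ξ η, (ξ, η) ∈ (pencil B A x).graph ↔ ξ = R η)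
    (hR' : ∀ ξ η, (ξ, η) ∈ (pencil B A y).graph ↔ ξ = R' η) {ξ η : Amplification d H}
    (h : ∀ i l v v', (ξ l, v) ∈ (y i).graph → (ξ l, v') ∈ (x i).graph → ‖v - v'‖ ≤ δ * ‖ξ l‖)
    (hξ : (ξ, η) ∈ (prePencil B A x).graph) (hξ' : ξ ∈ (prePencil B A y).domain) :
    ‖(R' - R) η‖ ≤ ε⁻¹ * ((∑ j, ∑ i, ∑ l, ‖A i j l‖) * (δ * ε⁻¹)) * ‖η‖ := by
  obtain ⟨η', hη'⟩ := LinearPMap.mem_domain_iff.1 hξ'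
  have h1 : ξ = R η := (hR _ _).1 (prePencil_le_pencil hξ)
  have h2 : ξ = R' η' := (hR' _ _).1 (prePencil_le_pencil hη')
  have h3 : (R' - R) η = R' (η - η') := by
    rw [sub_apply, ← h1, _root_.map_sub, ← h2]
  have h4 := norm_sub_le_of_mem_graph_prePencil h hδ hξ hη'
  have h5 : ‖ξ‖ ≤ ε⁻¹ * ‖η‖ := h1 ▸ R.le_of_opNorm_le hRn η
  rw [h3]
  calc ‖R' (η - η')‖ ≤ ε⁻¹ * ‖η - η'‖ := R'.le_of_opNorm_le hRn' _
    _ ≤ ε⁻¹ * ((∑ j, ∑ i, ∑ l, ‖A i j l‖) * (δ * (ε⁻¹ * ‖η‖))) := by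
        gcongr
        exact h4.trans (by gcongr)
    _ = _ := by ring

open scoped MatrixOrder in
theorem exists_eq_conjTranspose_mul_self {C : Matrix (Fin d) (Fin d) ℂ} (hC : C.PosSemidef) :
    ∃ D : Matrix (Fin d) (Fin d) ℂ, C = D.conjTranspose * D :=
  CStarAlgebra.nonneg_iff_eq_star_mul_self.1 hC.nonneg

theorem sum_inner_nonneg {C : Matrix (Fin d) (Fin d) ℂ} (hC : C.PosSemidef)
    (ξ : Amplification d H) : 0 ≤ (∑ j, ∑ l, C j l * ⟪ξ j, ξ l⟫_ℂ).re := by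
  obtain ⟨D, rfl⟩ := exists_eq_conjTranspose_mul_self hC
  have : ∑ j, ∑ l, (D.conjTranspose * D) j l * ⟪ξ j, ξ l⟫_ℂ =
      ∑ m, ⟪∑ j, D m j • ξ j, ∑ l, D m l • ξ l⟫_ℂ := by
    simp only [Matrix.mul_apply, Matrix.conjTranspose_apply, sum_inner, inner_sum,
      inner_smul_left, inner_smul_right, Finset.sum_mul]
    rw [Finset.sum_congr rfl fun j _ => Finset.sum_comm, Finset.sum_comm]
    refine Finset.sum_congr rfl fun m _ => ?_
    rw [Finset.sum_comm]
    refine Finset.sum_congr rfl fun l _ => ?_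
    rw [Finset.mul_sum]
    refine Finset.sum_congr rfl fun j _ => ?_
    rw [RCLike.star_def]
    ring
  rw [this, Complex.re_sum]
  exact Finset.sum_nonneg fun m _ => inner_self_nonneg (𝕜 := ℂ)

variable [CompleteSpace H]

theorem inner_prePencil (hx : ∀ i, IsSelfAdjoint (x i)) (hA : ∀ i, (A i).IsHermitian)
    {ξ η ξ' η' : Amplification d H} (h : (ξ, η) ∈ (prePencil B A x).graph)
    (h' : (ξ', η') ∈ (prePencil (star B) A x).graph) : ⟪η', ξ⟫_ℂ = ⟪ξ', η⟫_ℂ := by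
  obtain ⟨ζ, hζ, hη⟩ := mem_graph_prePencil.1 h
  obtain ⟨ζ', hζ', hη'⟩ := mem_graph_prePencil.1 h'
  rw [PiLp.inner_apply, PiLp.inner_apply]
  simp only [hη, hη', inner_sub_left, inner_sub_right, sum_inner, inner_sum, inner_smul_left,
    inner_smul_right, Finset.sum_sub_distrib]
  congr 1
  · rw [Finset.sum_comm]
    refine Finset.sum_congr rfl fun l _ => Finset.sum_congr rfl fun j _ => ?_
    simp [Matrix.star_apply]
  · rw [Finset.sum_comm]
    conv_rhs => rw [Finset.sum_comm]
    refine Finset.sum_congr rfl fun i _ => ?_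
    rw [Finset.sum_comm]
    refine Finset.sum_congr rfl fun l _ => Finset.sum_congr rfl fun j _ => ?_
    rw [inner_graph_symm (hx i) (hζ' i l) (hζ i j)]
    congr 1
    exact (hA i).apply l j

theorem norm_le_of_mem_graph_prePencil (hx : ∀ i, IsSelfAdjoint (x i))
    (hA : ∀ i, (A i).IsHermitian) {ε : ℝ}
    (hB : ((ℑ B : Matrix (Fin d) (Fin d) ℂ) - (ε : ℂ) • (1 : Matrix (Fin d) (Fin d) ℂ)).PosDef)
    {ξ η : Amplification d H} (h : (ξ, η) ∈ (prePencil B A x).graph) : ε * ‖ξ‖ ≤ ‖η‖ := by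
  obtain ⟨ζ, hζ, hη⟩ := mem_graph_prePencil.1 h
  obtain ⟨η', hη'⟩ : ∃ η' : Amplification d H, ∀ j, η' j =
    ∑ l, (star B) j l • ξ l - ∑ i, ∑ l, A i j l • ζ i l := ⟨WithLp.toLp 2 _, fun j => rfl⟩
  have h' : (ξ, η') ∈ (prePencil (star B) A x).graph := mem_graph_prePencil.2 ⟨ζ, hζ, hη'⟩
  have h1 := inner_prePencil hx hA h h'
  have h2 : ⟪ξ, η - η'⟫_ℂ = ∑ j, ∑ l, (B - star B) j l * ⟪ξ j, ξ l⟫_ℂ := by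
    rw [PiLp.inner_apply]
    refine Finset.sum_congr rfl fun j _ => ?_
    rw [PiLp.sub_apply, hη, hη', sub_sub_sub_cancel_right, ← Finset.sum_sub_distrib, inner_sum]
    refine Finset.sum_congr rfl fun l _ => ?_
    rw [← sub_smul, inner_smul_right, Matrix.sub_apply]
  have h3 : ⟪ξ, η - η'⟫_ℂ = (2 * (⟪ξ, η⟫_ℂ).im : ℝ) * Complex.I := by
    rw [inner_sub_right, ← inner_conj_symm ξ η', h1, Complex.sub_conj]
  have h4 := sum_inner_nonneg hB.posSemidef ξ
  have h5 : ∀ j l, ((ℑ B : Matrix (Fin d) (Fin d) ℂ) - (ε : ℂ) • (1 : Matrix (Fin d) (Fin d) ℂ)) j l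
      = -Complex.I / 2 * (B - star B) j l - if j = l then (ε : ℂ) else 0 := by
    intro j l
    rw [imaginaryPart_apply_coe]
    simp [Matrix.one_apply]
    ring
  have h6 : ∑ j, ⟪ξ j, ξ j⟫_ℂ = ((‖ξ‖ ^ 2 : ℝ) : ℂ) := by
    rw [← PiLp.inner_apply, inner_self_eq_norm_sq_to_K]
    norm_cast
  have h7 : ∑ j, ∑ l,
      ((ℑ B : Matrix (Fin d) (Fin d) ℂ) - (ε : ℂ) • (1 : Matrix (Fin d) (Fin d) ℂ)) j l
      * ⟪ξ j, ξ l⟫_ℂ = (((⟪ξ, η⟫_ℂ).im - ε * ‖ξ‖ ^ 2 : ℝ) : ℂ) := by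
    simp only [h5, sub_mul, Finset.sum_sub_distrib, ite_mul, zero_mul, Finset.sum_ite_eq,
      Finset.mem_univ, if_true, ← Finset.mul_sum, mul_assoc, h6]
    rw [← h2, h3]
    push_cast
    linear_combination (-(⟪ξ, η⟫_ℂ).im : ℂ) * Complex.I_sq
  rw [h7, Complex.ofReal_re] at h4
  have h8 : (⟪ξ, η⟫_ℂ).im ≤ ‖ξ‖ * ‖η‖ :=
    (Complex.abs_im_le_norm _ |> (le_abs_self _).trans).trans (norm_inner_le_norm _ _)
  rcases eq_or_ne ξ 0 with rfl | h9
  · simp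
  · refine le_of_mul_le_mul_left ?_ (norm_pos_iff.2 h9)
    nlinarith

variable {F : TraceData H}

theorem isClosable_prePencil (hx : ∀ i, IsSelfAdjoint (x i)) (hA : ∀ i, (A i).IsHermitian)
    (hd : Dense ((prePencil (star B) A x).domain : Set (Amplification d H))) :
    (prePencil B A x).IsClosable :=
  isClosable_of_isFormalAdjoint (T := prePencil (star B) A x) (fun u v =>
    inner_prePencil hx hA ((prePencil B A x).mem_graph v) ((prePencil (star B) A x).mem_graph u)) hd

theorem exists_domain_subspace (hx : ∀ i, F.Affiliated (x i)) {δ : ℝ} (hδ : 0 < δ) :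
    ∃ V : Submodule ℂ (Amplification d H), (F.amp d).Inv V ∧
      IsClosed (V : Set (Amplification d H)) ∧ V ≤ (prePencil B A x).domain ∧
      (F.amp d).codim V ≤ δ := by
  obtain ⟨V, h1, h2, h3, h4⟩ := TraceData.Affiliated.exists_common_subspace hx
    (δ := δ / (d * k + 1)) (by positivity)
  refine ⟨ampSub d V, h1.ampSub d, isClosed_ampSub d h2, fun ξ hξ => ?_, ?_⟩
  · rw [mem_ampSub] at hξ
    exact mem_domain_prePencil.2 fun i l => h3 i (hξ l)
  · rw [TraceData.codim_ampSub]
    rw [Fintype.card_fin] at h4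
    calc (d : ℝ) * F.codim V ≤ d * (k * (δ / (d * k + 1))) := by gcongr
      _ = (d * k) / (d * k + 1) * δ := by ring
      _ ≤ 1 * δ := by
        gcongr
        exact div_le_one_of_le₀ (by linarith) (by positivity)
      _ = δ := one_mul δ

theorem graph_prePencil_commute (hx : ∀ i, F.Affiliated (x i)) :
    ∀ Y ∈ (F.amp d).comm, ∀ ξ η : Amplification d H, (ξ, η) ∈ (prePencil B A x).graph →
      (Y ξ, Y η) ∈ (prePencil B A x).graph := by
  rintro _ ⟨y, hy, rfl⟩ ξ η h
  exact graph_prePencil_diag (fun i u v huv => (hx i).graph_commute hy huv) h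

theorem dense_domain_prePencil (hx : ∀ i, F.Affiliated (x i)) :
    Dense ((prePencil B A x).domain : Set (Amplification d H)) := by
  refine TraceData.dense_of_codim_le (F := F.amp d) ?_ fun δ hδ => ?_
  · intro Y hY ξ hξ
    obtain ⟨η, hη⟩ := LinearPMap.mem_domain_iff.1 hξ
    exact LinearPMap.mem_domain_iff.2 ⟨_, graph_prePencil_commute hx Y hY ξ η hη⟩
  · obtain ⟨V, h1, _, h3, h4⟩ := exists_domain_subspace hx hδ
    exact ⟨V, h1, h3, h4⟩

theorem exists_image_prePencil (hx : ∀ i, F.Affiliated (x i)) (hA : ∀ i, (A i).IsHermitian)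
    {ε : ℝ} (hε : 0 < ε)
    (hB : ((ℑ B : Matrix (Fin d) (Fin d) ℂ) - (ε : ℂ) • (1 : Matrix (Fin d) (Fin d) ℂ)).PosDef)
    {V : Submodule ℂ (Amplification d H)} (hVi : (F.amp d).Inv V)
    (hVc : IsClosed (V : Set (Amplification d H))) (hV : V ≤ (prePencil B A x).domain) :
    ∃ W : Submodule ℂ (Amplification d H), (F.amp d).Inv W ∧ (F.amp d).codim W ≤ (F.amp d).codim V ∧
      ∀ η ∈ W, ∃ ξ ∈ V, (ξ, η) ∈ (prePencil B A x).graph := by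
  refine TraceData.exists_image (isClosable_prePencil (fun i => (hx i).1) hA
    (dense_domain_prePencil hx)) (graph_prePencil_commute hx) (fun ξ hξ => ?_) hVi hVc hV
  have := norm_le_of_mem_graph_prePencil (fun i => (hx i).1) hA hB hξ
  rw [norm_zero] at this
  exact norm_le_zero_iff.1 (nonpos_of_mul_nonpos_right this hε)

theorem exists_inverse_pencil (hx : ∀ i, F.Affiliated (x i)) (hA : ∀ i, (A i).IsHermitian)
    {ε : ℝ} (hε : 0 < ε)
    (hB : ((ℑ B : Matrix (Fin d) (Fin d) ℂ) - (ε : ℂ) • (1 : Matrix (Fin d) (Fin d) ℂ)).PosDef) :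
    ∃ R : Amplification d H →L[ℂ] Amplification d H, R ∈ (F.amp d).alg ∧ ‖R‖ ≤ ε⁻¹ ∧
      ∀ ξ η, (ξ, η) ∈ (pencil B A x).graph ↔ ξ = R η := by
  have hcl := isClosable_prePencil (B := B) (fun i => (hx i).1) hA (dense_domain_prePencil hx)
  have hgraph : (pencil B A x).graph = (prePencil B A x).graph.topologicalClosure :=
    hcl.graph_closure_eq_closure_graph.symm
  have hrange : Dense {η : Amplification d H | ∃ ξ, (ξ, η) ∈ (pencil B A x).graph} := by
    have h1 : Dense ((prePencil B A x).graph.map (LinearMap.snd ℂ _ _) :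
        Set (Amplification d H)) := by
      refine TraceData.dense_of_codim_le (F := F.amp d) ?_ fun δ hδ => ?_
      · rintro Y hY _ ⟨⟨ξ, η⟩, h, rfl⟩
        exact ⟨_, graph_prePencil_commute hx Y hY ξ η h, rfl⟩
      · obtain ⟨V, h1, h2, h3, h4⟩ := exists_domain_subspace (B := B) (A := A) (d := d) hx hδ
        obtain ⟨W, h5, h6, h7⟩ := exists_image_prePencil hx hA hε hB h1 h2 h3
        refine ⟨W, h5, fun η hη => ?_, h6.trans h4⟩
        obtain ⟨ξ, _, hξ⟩ := h7 η hη
        exact ⟨_, hξ, rfl⟩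
    refine h1.mono ?_
    rintro _ ⟨⟨ξ, η⟩, h, rfl⟩
    exact ⟨ξ, prePencil_le_pencil h⟩
  have hbound : ∀ ξ η, (ξ, η) ∈ (pencil B A x).graph → ε * ‖ξ‖ ≤ ‖η‖ := by
    intro ξ η h
    rw [hgraph] at h
    exact norm_le_of_mem_topologicalClosure
      (fun u v huv => norm_le_of_mem_graph_prePencil (fun i => (hx i).1) hA hB huv) h
  obtain ⟨R, hR, hRn⟩ := exists_bounded_inverse (G := (pencil B A x).graph)
    hcl.closure_isClosed hε hbound hrange
  refine ⟨R, (F.amp d).mem_alg.2 fun Y hY => ?_, hRn, hR⟩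
  ext1 η
  refine (hR _ _).1 ?_
  have h : (R η, η) ∈ (pencil B A x).graph := (hR _ _).2 rfl
  rw [hgraph] at h ⊢
  exact map_mem_topologicalClosure (graph_prePencil_commute hx Y hY) h

end Pencil

end

noncomputable section

variable {H : Type*} [NormedAddCommGroup H] [InnerProductSpace ℂ H] [CompleteSpace H]

theorem IsAbsoluteValue.norm_le {b c : H →ₗ.[ℂ] H} (h : IsAbsoluteValue b c)
    (hb : Dense (b.domain : Set H)) {E : ProjectionValuedMeasure H} (hE : IsSpectralMeasure c E)
    {δ : ℝ} {ξ v : H} (hξ : ξ ∈ E.subspace (Set.Icc (-δ) δ)) (hv : (ξ, v) ∈ b.graph) :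
    ‖v‖ ≤ δ * ‖ξ‖ := by
  have hs := h.isSelfAdjoint
  set x : c.domain := ⟨ξ, hE.subspace_le_domain δ hξ⟩ with hx
  have hm := hE.apply_mem_subspace hs measurableSet_Icc (ξ := x) hξ
  set z : c.domain := ⟨c x, hE.subspace_le_domain δ hm⟩ with hz
  obtain ⟨w, hw, hw'⟩ := (h.sq_eq ξ (c z)).1 ⟨c x, c.mem_graph x, c.mem_graph z⟩
  obtain rfl := b.mem_graph_snd_inj hv hw rfl
  obtain ⟨p, hp, hp'⟩ := (LinearPMap.mem_graph_iff _).1 hw'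
  obtain ⟨q, hq, hq'⟩ := (LinearPMap.mem_graph_iff _).1 hv
  have h1 := LinearPMap.adjoint_isFormalAdjoint hb p q
  simp only at hp hp' hq hq'
  rw [hp', hq, hp, hq'] at h1
  have h2 : ⟪c z, (x : H)⟫_ℂ = ⟪c x, c x⟫_ℂ := isFormalAdjoint_self hs z x
  have h3 : ‖v‖ ^ 2 = ‖c x‖ ^ 2 := by
    have h4 : ⟪v, v⟫_ℂ = ⟪c x, c x⟫_ℂ := h1.symm.trans h2
    rw [← inner_self_eq_norm_sq (𝕜 := ℂ), ← inner_self_eq_norm_sq (𝕜 := ℂ), h4]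
  rw [(sq_eq_sq₀ (norm_nonneg _) (norm_nonneg _)).1 h3]
  exact hE.norm_apply_le hs hξ

section Probability

variable {M : VonNeumannAlgebra H} {τ : M.toStarSubalgebra →ₗ[ℂ] ℂ}
  (hτ : IsFaithfulNormalTracialState τ)

theorem eventually_isDistribution {b : ℕ → H →ₗ.[ℂ] H}
    (h : Tendsto (fun n => ∫ t, (1 : ℝ →ᵇ ℝ) t ∂(distribution τ (b n))) atTop
      (𝓝 (∫ t, (1 : ℝ →ᵇ ℝ) t ∂(Measure.dirac (0 : ℝ))))) :
    ∀ᶠ n in atTop, IsDistribution τ (b n) (distribution τ (b n)) := by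
  have h1 : ∫ t, (1 : ℝ →ᵇ ℝ) t ∂(Measure.dirac (0 : ℝ)) = 1 := by simp
  rw [h1] at h
  filter_upwards [h.eventually (lt_mem_nhds zero_lt_one)] with n hn
  by_cases hd : ∃ μ, IsDistribution τ (b n) μ
  · rw [distribution, dif_pos hd]
    exact hd.choose_spec
  · rw [distribution, dif_neg hd] at hn
    simp at hn

include hτ

theorem nontrivial_of_state : Nontrivial H := by
  by_contra hn
  rw [not_nontrivial_iff_subsingleton] at hn
  have h1 : (1 : M.toStarSubalgebra) = 0 := Subtype.ext (Subsingleton.elim _ _)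
  have := hτ.map_one
  rw [h1, _root_.map_zero] at this
  exact zero_ne_one this

theorem isAbsoluteValue_of_isDistribution {b : H →ₗ.[ℂ] H} {μ : Measure ℝ}
    (h : IsDistribution τ (absoluteValue b) μ) : IsAbsoluteValue b (absoluteValue b) := by
  by_cases hc : ∃ c, IsAbsoluteValue b c
  · rw [absoluteValue, dif_pos hc]
    exact hc.choose_spec
  · exfalso
    obtain ⟨_, E, hE, _⟩ := h
    rw [absoluteValue, dif_neg hc] at hE
    have := nontrivial_of_state hτ
    obtain ⟨ξ, hξ⟩ := exists_ne (0 : H)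
    have h0 : (⋃ n : ℕ, (E.subspace (Set.Icc (-(n : ℝ)) n) : Set H)) ⊆ {0} :=
      Set.iUnion_subset fun n => hE.subspace_le_domain n
    have h1 := closure_mono h0 (E.dense_iUnion_subspace ξ)
    rw [closure_singleton] at h1
    exact hξ h1

theorem dense_domain_sub {a b : H →ₗ.[ℂ] H} (ha : (TraceData.ofState hτ).Affiliated a)
    (hb : (TraceData.ofState hτ).Affiliated b) : Dense ((a - b).domain : Set H) := by
  refine TraceData.dense_of_codim_le (F := .ofState hτ) (ha.inv_domain.inf hb.inv_domain)
    fun δ hδ => ?_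
  obtain ⟨V, h1, h2, h3, h4⟩ := ha.exists_subspace (half_pos hδ)
  obtain ⟨W, h5, h6, h7, h8⟩ := hb.exists_subspace (half_pos hδ)
  exact ⟨V ⊓ W, h1.inf h5, inf_le_inf h3 h7,
    (TraceData.codim_inf_le h1 h5 h2 h6).trans (by linarith)⟩

theorem TendstoInProbability.eventually_exists_subspace {a : ℕ → H →ₗ.[ℂ] H} {a₀ : H →ₗ.[ℂ] H}
    (ha : ∀ n, (TraceData.ofState hτ).Affiliated (a n))
    (ha₀ : (TraceData.ofState hτ).Affiliated a₀) (h : TendstoInProbability τ a a₀)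
    {δ : ℝ} (hδ : 0 < δ) :
    ∀ᶠ n in atTop, ∃ W : Submodule ℂ H, (TraceData.ofState hτ).Inv W ∧ IsClosed (W : Set H) ∧
      (TraceData.ofState hτ).codim W ≤ δ ∧
      ∀ ξ ∈ W, ∀ v v', (ξ, v) ∈ (a n).graph → (ξ, v') ∈ a₀.graph → ‖v - v'‖ ≤ δ * ‖ξ‖ := by
  let f : ℝ →ᵇ ℝ := BoundedContinuousFunction.ofNormedAddCommGroup (fun t => min |t| δ)
    (by fun_prop) δ fun t => by
      rw [Real.norm_of_nonneg (le_min (abs_nonneg _) hδ.le)]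
      exact min_le_right _ _
  have hf : ∀ t, f t = min |t| δ := fun t => rfl
  have h1 := h f
  have h2 : ∫ t, f t ∂(Measure.dirac (0 : ℝ)) = 0 := by
    rw [integral_dirac, hf, abs_zero, min_eq_left hδ.le]
  rw [h2] at h1
  filter_upwards [eventually_isDistribution (h 1),
    h1.eventually (gt_mem_nhds (show 0 < δ * δ by positivity))] with n hn hn'
  set μ := distribution τ (absoluteValue (strongSub (a n) a₀)) with hμ
  have habs := isAbsoluteValue_of_isDistribution hτ hn
  obtain ⟨hp, E, hE, hEμ⟩ := hn
  have hm : ∀ S, MeasurableSet S → E.proj S ∈ (TraceData.ofState hτ).alg := fun S hS =>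
    (mem_alg_ofState hτ).2 (hEμ S hS).1
  refine ⟨E.subspace (Set.Icc (-δ) δ), TraceData.inv_subspace (hm _ measurableSet_Icc),
    E.isClosed_subspace _, ?_, fun ξ hξ v v' hv hv' => ?_⟩
  · obtain ⟨hM, hτμ⟩ := hEμ _ (measurableSet_Icc (a := -δ) (b := δ)).compl
    rw [TraceData.codim_subspace measurableSet_Icc, ofState_t hτ hM, hτμ, Complex.ofReal_re]
    have h3 := mul_meas_ge_le_integral_of_nonneg (μ := μ) (f := f)
      (Eventually.of_forall fun t => by rw [hf]; exact le_min (abs_nonneg _) hδ.le)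
      (f.integrable _) δ
    have h4 : μ.real (Set.Icc (-δ) δ)ᶜ ≤ μ.real {t | δ ≤ f t} := by
      refine measureReal_mono fun t ht => ?_
      have h5 : ¬ |t| ≤ δ := fun h => ht (abs_le.1 h)
      exact le_min (not_le.1 h5).le le_rfl
    have h6 : δ * μ.real {t | δ ≤ f t} < δ * δ := h3.trans_lt hn'
    exact h4.trans (lt_of_mul_lt_mul_left h6 hδ.le).le
  · have hle : a n - a₀ ≤ strongSub (a n) a₀ := LinearPMap.le_closure _
    refine habs.norm_le ((dense_domain_sub hτ (ha n) ha₀).mono hle.1) hE hξ ?_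
    exact LinearPMap.le_graph_of_le hle (mem_graph_sub.2 ⟨v, v', hv, hv', rfl⟩)

end Probability

section Convergence

open Amplification

variable {M : VonNeumannAlgebra H} {τ : M.toStarSubalgebra →ₗ[ℂ] ℂ}
  (hτ : IsFaithfulNormalTracialState τ)

/-- Entrywise estimate for an operator that is small on a subspace of small codimension. -/
theorem norm_state_entry_le {d : ℕ} {D : Amplification d H →L[ℂ] Amplification d H}
    (hD : D ∈ ((TraceData.ofState hτ).amp d).alg) {U : Submodule ℂ (Amplification d H)}
    (hU : ((TraceData.ofState hτ).amp d).Inv U) {c C κ : ℝ} (hc : 0 ≤ c)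
    (hDU : ∀ η ∈ U, ‖D η‖ ≤ c * ‖η‖) (hDC : ‖D‖ ≤ C)
    (hκ : ((TraceData.ofState hτ).amp d).codim U ≤ κ) (j l : Fin d)
    (hm : entry D j l ∈ M.toStarSubalgebra) :
    ‖τ ⟨entry D j l, hm⟩‖ ≤ c + d * (C * √κ) := by
  set F := TraceData.ofState hτ with hF
  set P := Uᗮ.starProjection with hP
  have hPm : P ∈ (F.amp d).alg := hU.orthogonal.starProjection_mem
  have hPp : IsStarProjection P := isStarProjection_starProjection
  have hentry : ∀ {Q : Amplification d H →L[ℂ] Amplification d H}, Q ∈ (F.amp d).alg →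
      ∀ j l, entry Q j l ∈ M.toStarSubalgebra := fun hQ j l =>
    (mem_alg_ofState hτ).1 ((F.mem_alg_amp).1 hQ j l)
  have hQm : D * (1 - P) ∈ (F.amp d).alg := mul_mem hD (sub_mem (one_mem _) hPm)
  have hQ : ‖D * (1 - P)‖ ≤ c := by
    refine ContinuousLinearMap.opNorm_le_bound _ hc fun η => ?_
    have h1 : (1 - P) η ∈ U.topologicalClosure := by
      rw [← Submodule.orthogonal_orthogonal_eq_closure, hP,
        ← TraceData.starProjection_orthogonal_orthogonal]
      exact Submodule.starProjection_apply_mem _ _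
    have h2 : ‖D ((1 - P) η)‖ ≤ c * ‖(1 - P) η‖ :=
      closure_minimal (s := (U : Set (Amplification d H)))
        (t := {ζ | ‖D ζ‖ ≤ c * ‖ζ‖}) hDU (isClosed_le (by fun_prop) (by fun_prop)) h1
    refine h2.trans (mul_le_mul_of_nonneg_left ?_ hc)
    rw [hP, ← TraceData.starProjection_orthogonal_orthogonal]
    exact Submodule.norm_starProjection_apply_le _ _
  have hPsq : ∀ m, (τ (star ⟨entry P m l, hentry hPm m l⟩ * ⟨entry P m l, hentry hPm m l⟩)).re
      ≤ κ := by
    intro m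
    have h1 : (F.amp d).t P = ∑ l, ∑ m, F.t (star (entry P m l) * entry P m l) := by
      conv_lhs => rw [← hPp.isIdempotentElem.eq]
      rw [F.amp_t]
      refine Finset.sum_congr rfl fun l _ => ?_
      rw [entry_mul, F.map_sum _ _ fun m _ => mul_mem ((F.mem_alg_amp).1 hPm _ _)
        ((F.mem_alg_amp).1 hPm _ _)]
      refine Finset.sum_congr rfl fun m _ => ?_
      rw [← entry_star, hPp.isSelfAdjoint.star_eq]
    have h2 : ∀ l m, 0 ≤ F.t (star (entry P m l) * entry P m l) := fun l m =>
      F.star_mul_self_nonneg _ ((F.mem_alg_amp).1 hPm m l)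
    have h3 : F.t (star (entry P m l) * entry P m l) ≤ (F.amp d).t P := by
      rw [h1]
      exact (Finset.single_le_sum (f := fun m => F.t (star (entry P m l) * entry P m l))
        (fun m _ => h2 l m) (Finset.mem_univ m)).trans
        (Finset.single_le_sum (f := fun l => ∑ m, F.t (star (entry P m l) * entry P m l))
        (fun l _ => Finset.sum_nonneg fun m _ => h2 l m) (Finset.mem_univ l))
    rw [ofState_t hτ (mul_mem (star_mem (hentry hPm m l)) (hentry hPm m l))] at h3
    exact h3.trans hκ
  have hsplit : (⟨entry D j l, hm⟩ : M.toStarSubalgebra) =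
      ⟨entry (D * (1 - P)) j l, hentry hQm j l⟩ +
        ∑ m, ⟨entry D j m, hentry hD j m⟩ * ⟨entry P m l, hentry hPm m l⟩ := by
    apply Subtype.ext
    simp only [AddMemClass.coe_add, AddSubmonoidClass.coe_finsetSum, MulMemClass.coe_mul]
    rw [← entry_mul, ← entry_add, ← mul_add, sub_add_cancel, mul_one]
  rw [hsplit, _root_.map_add, _root_.map_sum]
  refine (norm_add_le _ _).trans (add_le_add ?_ ?_)
  · exact (norm_state_le hτ _).trans ((norm_entry_le _ j l).trans hQ)
  · refine (norm_sum_le _ _).trans ((Finset.sum_le_sum (g := fun _ => C * √κ)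
      fun m _ => ?_).trans_eq ?_)
    · refine (norm_state_mul_le hτ _ _).trans (mul_le_mul ((norm_entry_le D j m).trans hDC)
        (Real.sqrt_le_sqrt (hPsq m)) (Real.sqrt_nonneg _) ((norm_nonneg _).trans hDC))
    · simp

end Convergence

end

noncomputable section

section Main

open Amplification

variable {H : Type*} [NormedAddCommGroup H] [InnerProductSpace ℂ H] [CompleteSpace H]
  {M : VonNeumannAlgebra H} {τ : M.toStarSubalgebra →ₗ[ℂ] ℂ}
  (hτ : IsFaithfulNormalTracialState τ)

theorem IsAffiliatedSelfAdjoint.affiliated {a : H →ₗ.[ℂ] H} (h : IsAffiliatedSelfAdjoint M a) :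
    (TraceData.ofState hτ).Affiliated a := by
  obtain ⟨hs, E, hE, hm⟩ := h
  exact ⟨hs, E, hE, fun S hS => (mem_alg_ofState hτ).2 (hm S hS)⟩

/-- If the coefficients are close on subspaces of small codimension, then so are the expected
resolvents. -/
theorem norm_state_entry_sub_le {d k : ℕ} {B : Matrix (Fin d) (Fin d) ℂ}
    {A : Fin k → Matrix (Fin d) (Fin d) ℂ} {x y : Fin k → H →ₗ.[ℂ] H}
    (hx : ∀ i, (TraceData.ofState hτ).Affiliated (x i))
    (hy : ∀ i, (TraceData.ofState hτ).Affiliated (y i))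
    (hA : ∀ i, (A i).IsHermitian) {ε : ℝ} (hε : 0 < ε)
    (hB : ((ℑ B : Matrix (Fin d) (Fin d) ℂ) - (ε : ℂ) • (1 : Matrix (Fin d) (Fin d) ℂ)).PosDef)
    {R R' : Amplification d H →L[ℂ] Amplification d H}
    (hRm : R ∈ ((TraceData.ofState hτ).amp d).alg) (hRm' : R' ∈ ((TraceData.ofState hτ).amp d).alg)
    (hRn : ‖R‖ ≤ ε⁻¹) (hRn' : ‖R'‖ ≤ ε⁻¹)
    (hR : ∀ ξ η, (ξ, η) ∈ (pencil B A x).graph ↔ ξ = R η)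
    (hR' : ∀ ξ η, (ξ, η) ∈ (pencil B A y).graph ↔ ξ = R' η) {δ : ℝ} (hδ : 0 < δ)
    (hW : ∀ i, ∃ W : Submodule ℂ H, (TraceData.ofState hτ).Inv W ∧ IsClosed (W : Set H) ∧
      (TraceData.ofState hτ).codim W ≤ δ ∧
      ∀ ξ ∈ W, ∀ v v', (ξ, v) ∈ (y i).graph → (ξ, v') ∈ (x i).graph → ‖v - v'‖ ≤ δ * ‖ξ‖)
    (j l : Fin d) (hm : entry (R' - R) j l ∈ M.toStarSubalgebra) :
    ‖τ ⟨entry (R' - R) j l, hm⟩‖ ≤ ε⁻¹ * ((∑ j, ∑ i, ∑ l, ‖A i j l‖) * (δ * ε⁻¹)) +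
      d * ((ε⁻¹ + ε⁻¹) * √(d * (3 * k * δ))) := by
  choose W hW1 hW2 hW3 hW4 using hW
  obtain ⟨i1, i2, i3⟩ := TraceData.codim_biInf_le Finset.univ W (fun i _ => hW1 i) fun i _ => hW2 i
  obtain ⟨V, v1, v2, v3, v4⟩ := TraceData.Affiliated.exists_common_subspace hx hδ
  obtain ⟨V', u1, u2, u3, u4⟩ := TraceData.Affiliated.exists_common_subspace hy hδ
  set Z : Submodule ℂ H := (⨅ i ∈ Finset.univ, W i) ⊓ (V ⊓ V') with hZ
  have hZi : (TraceData.ofState hτ).Inv Z := i1.inf (v1.inf u1)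
  have hVc : IsClosed ((V ⊓ V' : Submodule ℂ H) : Set H) := v2.inter u2
  have hZc : IsClosed (Z : Set H) := i2.inter hVc
  have hZδ : (TraceData.ofState hτ).codim Z ≤ 3 * k * δ := by
    have h1 := TraceData.codim_inf_le i1 (v1.inf u1) i2 hVc
    have h2 := TraceData.codim_inf_le v1 u1 v2 u2
    have h3 : ∑ i, (TraceData.ofState hτ).codim (W i) ≤ k * δ :=
      (Finset.sum_le_sum fun i _ => hW3 i).trans_eq (by simp)
    rw [Fintype.card_fin] at v4 u4
    linarith
  obtain ⟨U, hU1, hU2, hU3⟩ := exists_image_prePencil hx hA hε hB (hZi.ampSub d)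
    (isClosed_ampSub d hZc) (fun ξ hξ => mem_domain_prePencil.2 fun i l =>
      v3 i (mem_ampSub.1 hξ l).2.1)
  refine norm_state_entry_le hτ (sub_mem hRm' hRm) hU1 (by positivity) (fun η hη => ?_)
    ((norm_sub_le _ _).trans (add_le_add hRn' hRn)) ?_ j l hm
  · obtain ⟨ξ, hξ, hξη⟩ := hU3 η hη
    have hξ' := mem_ampSub.1 hξ
    refine norm_sub_apply_le hδ.le hε hRn hRn' hR hR' (fun i l => ?_) hξη
      (mem_domain_prePencil.2 fun i l => u3 i (hξ' l).2.2)
    exact hW4 i _ ((iInf₂_le i (Finset.mem_univ i) : _ ≤ W i) (hξ' l).1)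
  · refine hU2.trans ?_
    rw [TraceData.codim_ampSub]
    gcongr

include hτ in
/-- Convergence in probability implies joint convergence of matricial Cauchy transforms. -/
theorem tendstoJointlyInDistribution {k : ℕ} {X : Fin k → ℕ → H →ₗ.[ℂ] H}
    {x : Fin k → H →ₗ.[ℂ] H} (hX : ∀ i N, IsAffiliatedSelfAdjoint M (X i N))
    (hx : ∀ i, IsAffiliatedSelfAdjoint M (x i)) (hconv : ∀ i, TendstoInProbability τ (X i) (x i)) :
    TendstoJointlyInDistribution τ X x := by
  intro d A B hA ⟨ε, hε, hB⟩
  have hx' := fun i => (hx i).affiliated hτ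
  have hX' := fun N i => (hX i N).affiliated hτ
  obtain ⟨R, hRm, hRn, hR⟩ := exists_inverse_pencil hx' hA hε hB
  choose RN hRNm hRNn hRN using fun N => exists_inverse_pencil (hX' N) hA hε hB
  have hentry : ∀ {Q : Amplification d H →L[ℂ] Amplification d H},
      Q ∈ ((TraceData.ofState hτ).amp d).alg → ∀ j l, entry Q j l ∈ M.toStarSubalgebra :=
    fun hQ j l => (mem_alg_ofState hτ).1 (((TraceData.ofState hτ).mem_alg_amp).1 hQ j l)
  have hinv : ∀ {Q : Amplification d H →L[ℂ] Amplification d H} (ξ η : Amplification d H),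
      ξ = Q η ↔ ∀ j, ξ j = ∑ l, entry Q j l (η l) := fun ξ η => by
    simp only [← apply_eq_sum]
    exact ⟨fun h j => by rw [h], fun h => by ext j; exact h j⟩
  refine ⟨fun N => Matrix.of fun j l => ⟨entry (RN N) j l, hentry (hRNm N) j l⟩,
    Matrix.of fun j l => ⟨entry R j l, hentry hRm j l⟩,
    fun N ξ η => (hRN N ξ η).trans (hinv ξ η), fun ξ η => (hR ξ η).trans (hinv ξ η), ?_⟩
  have key : ∀ j l, Tendsto (fun N => τ ⟨entry (RN N) j l, hentry (hRNm N) j l⟩) atTop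
      (𝓝 (τ ⟨entry R j l, hentry hRm j l⟩)) := by
    intro j l
    rw [tendsto_iff_norm_sub_tendsto_zero]
    have hbound : Tendsto (fun δ : ℝ => ε⁻¹ * ((∑ j, ∑ i, ∑ l, ‖A i j l‖) * (δ * ε⁻¹)) +
        d * ((ε⁻¹ + ε⁻¹) * √(d * (3 * k * δ)))) (𝓝[>] 0) (𝓝 0) := by
      have hc : Continuous (fun δ : ℝ => ε⁻¹ * ((∑ j, ∑ i, ∑ l, ‖A i j l‖) * (δ * ε⁻¹)) +
        d * ((ε⁻¹ + ε⁻¹) * √(d * (3 * k * δ)))) := by fun_prop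
      have := hc.tendsto 0
      simp only [zero_mul, mul_zero, Real.sqrt_zero, add_zero] at this
      exact this.mono_left nhdsWithin_le_nhds
    rw [Metric.tendsto_atTop']
    intro e he
    obtain ⟨δ, hδe, hδ⟩ := ((hbound.eventually (gt_mem_nhds he)).and
      self_mem_nhdsWithin).exists
    obtain ⟨N₀, hN₀⟩ := (eventually_all.2 fun i =>
      (hconv i).eventually_exists_subspace hτ (fun N => hX' N i) (hx' i) hδ).exists_forall_of_atTop
    refine ⟨N₀, fun N hN => ?_⟩
    have h1 := norm_state_entry_sub_le hτ hx' (hX' N) hA hε hB hRm (hRNm N) hRn (hRNn N) hR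
      (hRN N) hδ (hN₀ N hN.le) j l (hentry (sub_mem (hRNm N) hRm) j l)
    have h2 : (⟨entry (RN N - R) j l, hentry (sub_mem (hRNm N) hRm) j l⟩ : M.toStarSubalgebra) =
        ⟨entry (RN N) j l, hentry (hRNm N) j l⟩ - ⟨entry R j l, hentry hRm j l⟩ :=
      Subtype.ext (entry_sub _ _ j l)
    rw [h2, _root_.map_sub] at h1
    rw [dist_zero_right, norm_norm]
    exact h1.trans_lt hδe
  have hmat : Tendsto (fun N => (Matrix.of fun j l => τ ⟨entry (RN N) j l, hentry (hRNm N) j l⟩ :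
      Matrix (Fin d) (Fin d) ℂ)) atTop
      (𝓝 (Matrix.of fun j l => τ ⟨entry R j l, hentry hRm j l⟩)) :=
    tendsto_pi_nhds.2 fun j => tendsto_pi_nhds.2 fun l => key j l
  open scoped Matrix.Norms.L2Operator in
  exact tendsto_iff_norm_sub_tendsto_zero.1 hmat

end Main

end

end FreeProb

theorem mainTheorem11 {H : Type*} [NormedAddCommGroup H] [InnerProductSpace ℂ H]
    [CompleteSpace H] (M : VonNeumannAlgebra H) (τ : M.toStarSubalgebra →ₗ[ℂ] ℂ)
    (hτ : FreeProb.IsFaithfulNormalTracialState τ)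
    {k : ℕ} (X : Fin k → ℕ → H →ₗ.[ℂ] H) (x : Fin k → H →ₗ.[ℂ] H)
    (hX : ∀ i N, FreeProb.IsAffiliatedSelfAdjoint M (X i N))
    (hx : ∀ i, FreeProb.IsAffiliatedSelfAdjoint M (x i))
    (hconv : ∀ i, FreeProb.TendstoInProbability τ (X i) (x i)) :
    FreeProb.TendstoJointlyInDistribution τ X x :=
  FreeProb.tendstoJointlyInDistribution hτ hX hx hconv
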